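/- **Proposition 5.1.** Let $\gamma\in(0,1)$ and $r>\tfrac32$. Let $\eta\in C^{2,\gamma}(\mathbb R)$ be positive, put $D_\eta=\{(x,y): 0<y<\eta(x)\}$, and let $\psi\in C^{2,\gamma}(\overline{D_\eta})$ (Hölder spaces with finite norms on the whole line and on the whole closed domain) be the stream function of an irrotational steady wave with Bernoulli constant $r$, that is, $$\Delta\psi=0\ \text{ in } D_\eta,\qquad \tfrac12|\nabla\psi|^2+y=r\ \text{ and }\ \psi=1\ \text{ on } y=\eta(x),\qquad \psi=0\ \text{ on } y=0,$$ and $\psi_y>0$ for $0\le y\le\eta(x)$. Then $$\psi_y(x,0)>\frac1r\qquad\text{for all } x\in\mathbb R .$$ If moreover $(\psi,\eta)$ is not a supercritical uniform stream, that is, not of the form $\eta\equiv d$, $\psi(x,y)=y/d$ with a constant depth $d<1$, then also $$\psi_y(x,0)<\frac4r\qquad\text{for all } x\in\mathbb R .$$ -/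

import Mathlib

open scoped NNReal

/-- `f` belongs to the Hölder space `C^{2,γ}` on the (closed) set `s`: it is twice continuously
differentiable up to the boundary, its derivatives of order at most `2` are bounded on `s`, and
its second derivative is Hölder continuous on `s` with exponent `γ`. -/
def MemC2Holder {E : Type*} [NormedAddCommGroup E] [NormedSpace ℝ E]
    (γ : ℝ≥0) (f : E → ℝ) (s : Set E) : Prop :=
  ContDiffOn ℝ 2 f s ∧
    (∃ M : ℝ, ∀ k : ℕ, k ≤ 2 → ∀ z ∈ s, ‖iteratedFDerivWithin ℝ k f s z‖ ≤ M) ∧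
    ∃ C : ℝ≥0, HolderOnWith C γ (iteratedFDerivWithin ℝ 2 f s) s

/-- The fluid domain `0 < y < η(x)`; the plane is identified with `ℂ` through
`(x, y) ↦ x + i y`. -/
def fluidDomain (η : ℝ → ℝ) : Set ℂ :=
  {z | 0 < z.im ∧ z.im < η z.re}

/-- The closed fluid domain `0 ≤ y ≤ η(x)`. -/
def closedFluidDomain (η : ℝ → ℝ) : Set ℂ :=
  {z | 0 ≤ z.im ∧ z.im ≤ η z.re}

/-- The partial derivative `ψ_x` at a point of the closed fluid domain (at boundary points it is
taken from within the domain). -/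
noncomputable def partialX (η : ℝ → ℝ) (ψ : ℂ → ℝ) (z : ℂ) : ℝ :=
  fderivWithin ℝ ψ (closedFluidDomain η) z 1

/-- The partial derivative `ψ_y` at a point of the closed fluid domain (at boundary points it is
taken from within the domain). -/
noncomputable def partialY (η : ℝ → ℝ) (ψ : ℂ → ℝ) (z : ℂ) : ℝ :=
  fderivWithin ℝ ψ (closedFluidDomain η) z Complex.I

/-- `(ψ, η)` is a unidirectional irrotational steady water wave of class `C^{2,γ}` with Bernoulli
constant `r`, in non-dimensional variables (unit mass flux and unit gravity). -/
structure IsIrrotationalWave (γ : ℝ≥0) (r : ℝ) (ψ : ℂ → ℝ) (η : ℝ → ℝ) : Prop where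
  depth_pos : ∀ x : ℝ, 0 < η x
  profile_regular : MemC2Holder γ η Set.univ
  stream_regular : MemC2Holder γ ψ (closedFluidDomain η)
  /-- `Δψ = 0` in the fluid -/
  harmonic : InnerProductSpace.HarmonicOnNhd ψ (fluidDomain η)
  /-- `½ |∇ψ|² + y = r` on the surface `y = η(x)` -/
  bernoulli : ∀ x : ℝ,
    1 / 2 * (partialX η ψ ⟨x, η x⟩ ^ 2 + partialY η ψ ⟨x, η x⟩ ^ 2) + η x = r
  /-- `ψ = 1` on the surface -/
  surface : ∀ x : ℝ, ψ ⟨x, η x⟩ = 1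
  /-- `ψ = 0` on the bottom `y = 0` -/
  bottom : ∀ x : ℝ, ψ ⟨x, 0⟩ = 0
  /-- `ψ_y > 0` for `0 ≤ y ≤ η(x)` -/
  unidirectional : ∀ z ∈ closedFluidDomain η, 0 < partialY η ψ z

/-- `(ψ, η)` is the uniform stream of depth `d`: the surface is flat, `η ≡ d`, and
`ψ(x, y) = y / d`. -/
def IsUniformStream (d : ℝ) (ψ : ℂ → ℝ) (η : ℝ → ℝ) : Prop :=
  (∀ x : ℝ, η x = d) ∧ ∀ z ∈ closedFluidDomain η, ψ z = z.im / d

open Set Filter Topology Complex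

/-! Everything rests on comparison with explicit functions that vanish on the bottom. Besides `ψ`,
the second harmonic function is the flux potential `H`, with `H_x = ψ_x ψ_y` and `H_y = (ψ_y² -
ψ_x²) / 2`. By the Bernoulli and kinematic conditions, `S = H + r η - η² / 2` is constant along the
surface: it is the flow force (`exists_flowForce`).

Lower bound: since `η < r`, the harmonic function `ψ - y / r` is nonnegative, which gives `ψ_y ≥ 1 /
r` on the bottom. A local barrier `κ cos (x - x₀) sinh y` makes this strict (`inv_lt_Q_bottom`).

Upper bound: `S ψ - H - r y + y² / 2` is subharmonic and vanishes on the whole boundary, so `S u ≤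
u² / 2 + r` for each bottom velocity `u` (`bottom_flowForce`). Nonnegativity of the pressure gives
`u² < 2 r` (`energy_le`, `Q_bottom_sq_lt`), hence `S u < 2 r`, and it remains to show `S ≥ r² / 2`.

Let `d = sup η`. Comparing `ψ` with `y / d` near a crest gives `r ≤ 1 / (2 d²) + d`; the reverse
inequality holds for `inf η`. As `1 / (2 t²) + t` strictly decreases on `(0, 1)`, the case `d < 1`
forces a uniform stream. Otherwise `d ≥ 1`, so `τ = √(2 (r - d)) ≤ 1`. Comparing `H` with `ψ` near a
crest gives `S ≥ r d - d² / 2 + τ / 2 = r² / 2 - τ⁴ / 8 + τ / 2 ≥ r² / 2` (`flowForce_ge`).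

The domain is unbounded and `sup η`, `inf η` need not be attained. The maximum principle therefore
subtracts a growing superharmonic barrier, and the boundary-derivative arguments are made
quantitative at nearly extremal points. -/

/-! ### Maximum principle in an unbounded strip -/

/-- At a local maximum the second derivative is nonpositive. -/
theorem IsLocalMax.second_deriv_nonpos {φ φ' : ℝ → ℝ} {x c : ℝ} (hmax : IsLocalMax φ x)
    (hφ : ∀ᶠ t in 𝓝 x, HasDerivAt φ (φ' t) t) (hφ' : HasDerivAt φ' c x) : c ≤ 0 := by
  by_contra! hc
  have hderiv : deriv φ =ᶠ[𝓝 x] φ' := hφ.mono fun t ht => ht.deriv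
  have h2 : deriv (deriv φ) x = c := by rw [hderiv.deriv_eq, hφ'.deriv]
  have hmin : IsLocalMin φ x :=
    isLocalMin_of_deriv_deriv_pos (by rw [h2]; exact hc) hmax.deriv_eq_zero
      hφ.self_of_nhds.continuousAt
  have hconst : φ =ᶠ[𝓝 x] fun _ => φ x := by
    filter_upwards [hmax, hmin] with t h1 h2 using le_antisymm h1 h2
  have h3 : deriv φ =ᶠ[𝓝 x] fun _ => 0 := by
    simpa using hconst.deriv
  have h4 : deriv (deriv φ) x = 0 := by rw [h3.deriv_eq]; simp
  linarith

theorem hasDerivAt_re_comp {f : ℝ → ℂ} {f' : ℂ} {x : ℝ} (h : HasDerivAt f f' x) :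
    HasDerivAt (fun t => (f t).re) f'.re x :=
  reCLM.hasFDerivAt.comp_hasDerivAt x h

/-- The gradient of the real function `g` at `w` is the conjugate of the complex number `V`. -/
def HasConjGradAt (g : ℂ → ℝ) (V : ℂ) (w : ℂ) : Prop :=
  HasDerivAt (fun t : ℝ => g (w + t)) V.re 0 ∧ HasDerivAt (fun t : ℝ => g (w + t * I)) (-V.im) 0

namespace HasConjGradAt

variable {g₁ g₂ : ℂ → ℝ} {V₁ V₂ w : ℂ}

theorem add (h₁ : HasConjGradAt g₁ V₁ w) (h₂ : HasConjGradAt g₂ V₂ w) :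
    HasConjGradAt (fun z => g₁ z + g₂ z) (V₁ + V₂) w :=
  ⟨by rw [add_re]; exact h₁.1.add h₂.1,
    by rw [add_im, neg_add]; exact h₁.2.add h₂.2⟩

theorem const_mul (c : ℝ) (h₁ : HasConjGradAt g₁ V₁ w) :
    HasConjGradAt (fun z => c * g₁ z) (c * V₁) w :=
  ⟨by simpa using h₁.1.const_mul c, by simpa using h₁.2.const_mul c⟩

theorem const (c : ℝ) : HasConjGradAt (fun _ => c) 0 w :=
  ⟨by simpa using hasDerivAt_const (0 : ℝ) c, by simpa using hasDerivAt_const (0 : ℝ) c⟩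

theorem im : HasConjGradAt (fun z => z.im) (-I) w :=
  ⟨by simpa using hasDerivAt_const (0 : ℝ) w.im,
    by simpa using (hasDerivAt_id (0 : ℝ)).const_add w.im⟩

theorem of_hasDerivAt {f : ℂ → ℂ} {f' : ℂ} (h : HasDerivAt f f' w) :
    HasConjGradAt (fun z => (f z).re) f' w := by
  constructor
  · have h1 : HasDerivAt (fun t : ℝ => w + (t : ℂ)) 1 0 := (ofRealCLM.hasDerivAt).const_add w
    have h2 : HasDerivAt f f' (w + ((0 : ℝ) : ℂ)) := by simpa using h
    simpa using hasDerivAt_re_comp (h2.comp (0 : ℝ) h1)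
  · have h1 : HasDerivAt (fun t : ℝ => w + (t : ℂ) * I) (1 * I) 0 :=
      ((ofRealCLM.hasDerivAt).mul_const I).const_add w
    have h2 : HasDerivAt f f' (w + ((0 : ℝ) : ℂ) * I) := by simpa using h
    simpa using hasDerivAt_re_comp (h2.comp (0 : ℝ) h1)

end HasConjGradAt

/-- A positive strictly superharmonic function on the strip `0 ≤ y ≤ R`, growing at infinity. -/
def stripBarrier (R : ℝ) (z : ℂ) : ℝ := z.re ^ 2 + 2 * R ^ 2 - 2 * z.im ^ 2

theorem continuous_stripBarrier (R : ℝ) : Continuous (stripBarrier R) := by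
  unfold stripBarrier
  fun_prop

/-- A Phragmén–Lindelöf principle in a strip: a bounded function which, after subtraction of a
multiple of the barrier, has no maximum at a point of positivity, is nonpositive. -/
theorem nonpos_of_forall_not_isMaxOn {s : Set ℂ} (hs : IsClosed s) {R : ℝ}
    (hsR : ∀ z ∈ s, 0 ≤ z.im ∧ z.im ≤ R) {f : ℂ → ℝ} (hf : ContinuousOn f s) {M : ℝ}
    (hM : ∀ z ∈ s, f z ≤ M)
    (hmax : ∀ z ∈ s, 0 < f z → ∀ ε > 0, ¬ IsMaxOn (fun z => f z - ε * stripBarrier R z) s z) :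
    ∀ z ∈ s, f z ≤ 0 := by
  have hb : ∀ z ∈ s, z.re ^ 2 ≤ stripBarrier R z := by
    intro z hz
    have := hsR z hz
    unfold stripBarrier
    nlinarith
  intro z₀ hz₀
  by_contra! hpos
  have hb₀ : 0 ≤ stripBarrier R z₀ := (sq_nonneg _).trans (hb z₀ hz₀)
  obtain ⟨ε, hε, hε'⟩ : ∃ ε > 0, 0 < f z₀ - ε * stripBarrier R z₀ := by
    refine ⟨f z₀ / (2 * (stripBarrier R z₀ + 1)), by positivity, ?_⟩
    have : f z₀ / (2 * (stripBarrier R z₀ + 1)) * stripBarrier R z₀ ≤ f z₀ / 2 := by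
      rw [div_mul_eq_mul_div, div_le_div_iff₀ (by positivity) (by positivity)]
      nlinarith
    linarith
  -- Beyond this radius, `|y| ≤ R` forces `x² > |M| / ε`, so `ε` times the barrier exceeds the upper
  -- bound `M` of `f`.
  set ρ := √(R ^ 2 + |M| / ε)
  have hout : ∀ z ∈ s, ρ < ‖z‖ → f z - ε * stripBarrier R z < 0 := by
    intro z hz hρ
    have h1 : R ^ 2 + |M| / ε < ‖z‖ ^ 2 := by
      rw [← Real.sq_sqrt (show 0 ≤ R ^ 2 + |M| / ε by positivity)]
      exact pow_lt_pow_left₀ hρ (Real.sqrt_nonneg _) two_ne_zero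
    have h2 : ‖z‖ ^ 2 = z.re ^ 2 + z.im ^ 2 := by
      rw [← normSq_eq_norm_sq, normSq_apply]; ring
    have h3 := hsR z hz
    have h4 : |M| / ε < z.re ^ 2 := by nlinarith
    rw [div_lt_iff₀ hε] at h4
    have h5 := hb z hz
    have h6 := hM z hz
    have h7 := le_abs_self M
    nlinarith
  have hcomp : IsCompact (s ∩ Metric.closedBall 0 ρ) :=
    (isCompact_closedBall 0 ρ).inter_left hs
  have hz₀' : z₀ ∈ s ∩ Metric.closedBall 0 ρ := by
    refine ⟨hz₀, ?_⟩
    rw [mem_closedBall_zero_iff]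
    by_contra! h
    linarith [hout z₀ hz₀ h]
  obtain ⟨z₁, hz₁, hz₁max⟩ := hcomp.exists_isMaxOn ⟨z₀, hz₀'⟩
    ((hf.mono inter_subset_left).sub
      (((continuous_stripBarrier R).continuousOn).const_mul ε) : ContinuousOn
        (fun z => f z - ε * stripBarrier R z) _)
  have h01 : f z₀ - ε * stripBarrier R z₀ ≤ f z₁ - ε * stripBarrier R z₁ := hz₁max hz₀'
  have hb₁ : 0 ≤ stripBarrier R z₁ := (sq_nonneg _).trans (hb z₁ hz₁.1)
  refine hmax z₁ hz₁.1 (by nlinarith) ε hε fun z hz => ?_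
  by_cases h : ‖z‖ ≤ ρ
  · exact hz₁max ⟨hz, mem_closedBall_zero_iff.2 h⟩
  · have := hout z hz (not_le.1 h)
    simp only [mem_ofPred_eq]
    linarith

/-- If `f` is touched from below at `z` by a harmonic function, then `f` minus a positive multiple
of the barrier has no interior maximum at `z`. -/
theorem not_isMaxOn_sub_stripBarrier {s : Set ℂ} {z : ℂ} (hs : s ∈ 𝓝 z) {f g : ℂ → ℝ}
    {V : ℂ → ℂ} (hV : DifferentiableAt ℂ V z) (hg : ∀ᶠ w in 𝓝 z, HasConjGradAt g (V w) w)
    (hle : ∀ᶠ w in 𝓝 z, g w ≤ f w) (heq : g z = f z) (R : ℝ) {ε : ℝ} (hε : 0 < ε) :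
    ¬ IsMaxOn (fun z => f z - ε * stripBarrier R z) s z := by
  intro hmax
  have hloc : ∀ᶠ w in 𝓝 z, g w - ε * stripBarrier R w ≤ g z - ε * stripBarrier R z := by
    filter_upwards [hs, hle] with w hw hle
    have := hmax hw
    simp only [mem_ofPred_eq] at this
    linarith
  -- The second derivative in direction `a` is `Re (V' a²) - 2 ε q`. For `a = 1` and `a = I` the
  -- terms in `V'` cancel, while `q = 1` and `q = -2` leave the sum `2 ε > 0`, so both cannot be
  -- nonpositive.
  have key : ∀ (a : ℂ) (d c q : ℝ),
      (∀ᶠ w in 𝓝 z, HasDerivAt (fun t : ℝ => g (w + t * a)) (V w * a).re 0) →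
      (∀ t : ℝ, stripBarrier R (z + t * a) = stripBarrier R z + d * t + q * t ^ 2) →
      c = (deriv V z * a * a).re - 2 * ε * q → c ≤ 0 := by
    intro a d c q hga hb hc
    have hline : Tendsto (fun t : ℝ => z + t * a) (𝓝 0) (𝓝 z) := by
      have : Continuous (fun t : ℝ => z + t * a) := by fun_prop
      simpa using this.tendsto 0
    have hl0 : HasDerivAt (fun t : ℝ => z + (t : ℂ) * a) (1 * a) 0 :=
      ((ofRealCLM.hasDerivAt).mul_const a).const_add z
    refine IsLocalMax.second_deriv_nonpos (x := 0)
      (φ := fun t : ℝ => g (z + t * a) - ε * (stripBarrier R z + d * t + q * t ^ 2))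
      (φ' := fun t : ℝ => (V (z + t * a) * a).re - ε * (d + 2 * q * t)) ?_ ?_ ?_
    · filter_upwards [hline.eventually hloc] with t ht
      rw [hb t] at ht
      simpa using ht
    · filter_upwards [hline.eventually hga] with t ht
      have h1 : HasDerivAt (fun u : ℝ => g (z + u * a)) (V (z + t * a) * a).re t := by
        have h2 : HasDerivAt (fun u : ℝ => u - t) 1 t := (hasDerivAt_id t).sub_const t
        have h3 : HasDerivAt (fun t_1 : ℝ => g (z + t * a + t_1 * a)) (V (z + t * a) * a).re
          (t - t) := by simpa using ht
        have h4 := HasDerivAt.comp (h := fun u : ℝ => u - t) t h3 h2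
        rw [mul_one] at h4
        refine h4.congr_of_eventuallyEq (Eventually.of_forall fun u => ?_)
        simp only [Function.comp]
        congr 1
        push_cast
        ring
      refine h1.sub (HasDerivAt.const_mul ε ?_)
      have h5 := (((hasDerivAt_id t).const_mul d).const_add (stripBarrier R z)).add
        (((hasDerivAt_id t).pow 2).const_mul q)
      refine h5.congr_deriv ?_
      simp
      ring
    · have hV' : HasDerivAt V (deriv V z) (z + ((0 : ℝ) : ℂ) * a) := by simpa using hV.hasDerivAt
      have h1 := hasDerivAt_re_comp ((hV'.comp (0 : ℝ) hl0).mul_const a)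
      have h2 := (((hasDerivAt_id (0 : ℝ)).const_mul (2 * q)).const_add d).const_mul ε
      refine (h1.sub h2).congr_deriv ?_
      rw [hc, one_mul]
      ring
  have hx := key 1 (2 * z.re) _ 1 (hg.mono fun w hw => by simpa using hw.1)
    (fun t => by simp [stripBarrier]; ring) rfl
  have hy := key I (-4 * z.im) _ (-2) (hg.mono fun w hw => by simpa using hw.2)
    (fun t => by simp [stripBarrier]; ring) rfl
  have hI : deriv V z * I * I = - deriv V z := by rw [mul_assoc, I_mul_I]; ring
  rw [hI] at hy
  simp only [mul_one, neg_re] at hx hy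
  linarith

/-- The maximum principle for functions that are touched from below by harmonic functions at the
interior points where they are positive. -/
theorem nonpos_of_touching {s : Set ℂ} (hs : IsClosed s) {R : ℝ}
    (hsR : ∀ z ∈ s, 0 ≤ z.im ∧ z.im ≤ R) {f : ℂ → ℝ} (hf : ContinuousOn f s) {M : ℝ}
    (hM : ∀ z ∈ s, f z ≤ M)
    (h : ∀ z ∈ s, 0 < f z → s ∈ 𝓝 z ∧ ∃ (g : ℂ → ℝ) (V : ℂ → ℂ), DifferentiableAt ℂ V z ∧
      (∀ᶠ w in 𝓝 z, HasConjGradAt g (V w) w) ∧ (∀ᶠ w in 𝓝 z, g w ≤ f w) ∧ g z = f z) :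
    ∀ z ∈ s, f z ≤ 0 := by
  refine nonpos_of_forall_not_isMaxOn hs hsR hf hM fun z hz hpos ε hε => ?_
  obtain ⟨hn, g, V, hV, hg, hle, heq⟩ := h z hz hpos
  exact not_isMaxOn_sub_stripBarrier hn hV hg hle heq R hε

/-! ### Geometry of the closed fluid domain -/

/-- The real linear form `v ↦ a v.re + b v.im` on the plane. -/
noncomputable def planeForm (a b : ℝ) : ℂ →L[ℝ] ℝ := a • reCLM + b • imCLM

@[simp]
theorem planeForm_apply (a b : ℝ) (v : ℂ) : planeForm a b v = a * v.re + b * v.im := by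
  simp [planeForm]

theorem eq_planeForm (L : ℂ →L[ℝ] ℝ) : L = planeForm (L 1) (L I) := by
  ext v
  conv_lhs => rw [show v = v.re • (1 : ℂ) + v.im • I by simp]
  rw [map_add, map_smul, map_smul]
  simp [mul_comm]

section Domain

variable {η η' : ℝ → ℝ}

theorem isClosed_closedFluidDomain (hη : Continuous η) : IsClosed (closedFluidDomain η) :=
  (isClosed_le continuous_const continuous_im).inter
    (isClosed_le continuous_im (hη.comp continuous_re))

theorem isOpen_fluidDomain (hη : Continuous η) : IsOpen (fluidDomain η) :=
  (isOpen_lt continuous_const continuous_im).inter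
    (isOpen_lt continuous_im (hη.comp continuous_re))

theorem fluidDomain_subset : fluidDomain η ⊆ closedFluidDomain η :=
  fun _ hz => ⟨hz.1.le, hz.2.le⟩

theorem closedFluidDomain_mem_nhds (hη : Continuous η) {z : ℂ} (hz : z ∈ fluidDomain η) :
    closedFluidDomain η ∈ 𝓝 z :=
  mem_of_superset ((isOpen_fluidDomain hη).mem_nhds hz) fluidDomain_subset

/-- Each point is moved slightly along its vertical line towards half depth. This lets interior
identities between continuous functions pass to the boundary. -/
theorem closedFluidDomain_subset_closure (hpos : ∀ x, 0 < η x) :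
    closedFluidDomain η ⊆ closure (fluidDomain η) := by
  intro z hz
  have hc : Continuous fun t : ℝ => (⟨z.re, (1 - t) * z.im + t * (η z.re / 2)⟩ : ℂ) := by
    have : (fun t : ℝ => (⟨z.re, (1 - t) * z.im + t * (η z.re / 2)⟩ : ℂ)) =
        fun t : ℝ => (z.re : ℂ) + (((1 - t) * z.im + t * (η z.re / 2) : ℝ) : ℂ) * I := by
      ext t
      exact mk_eq_add_mul_I _ _
    rw [this]
    fun_prop
  have ht : Tendsto (fun t : ℝ => (⟨z.re, (1 - t) * z.im + t * (η z.re / 2)⟩ : ℂ)) (𝓝[>] 0)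
      (𝓝 z) := by
    have := (hc.tendsto 0).mono_left (nhdsWithin_le_nhds (s := Ioi 0))
    simpa using this
  refine mem_closure_of_tendsto ht ?_
  filter_upwards [Ioo_mem_nhdsGT (show (0 : ℝ) < 1 by norm_num)] with t ht
  have h1 := hpos z.re
  have h2 := hz.1
  have h3 := hz.2
  have h4 := ht.1
  have h5 := ht.2
  constructor
  · change 0 < (1 - t) * z.im + t * (η z.re / 2)
    nlinarith [mul_nonneg (sub_nonneg.2 h5.le) h2, mul_pos h4 h1]
  · change (1 - t) * z.im + t * (η z.re / 2) < η z.re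
    nlinarith [mul_nonneg (sub_nonneg.2 h5.le) (sub_nonneg.2 h3), mul_pos h4 h1]

/-- The flattening map `(x, y) ↦ (x, y η(x))` carries the convex strip `0 ≤ y ≤ 1` onto the domain,
and its derivative is invertible because `η > 0`. -/
theorem uniqueDiffOn_closedFluidDomain (hpos : ∀ x, 0 < η x)
    (hη : ∀ x, HasDerivAt η (η' x) x) : UniqueDiffOn ℝ (closedFluidDomain η) := by
  let S : Set ℂ := {z | 0 ≤ z.im ∧ z.im ≤ 1}
  have hSconv : Convex ℝ S :=
    (convex_halfSpace_im_ge 0).inter (convex_halfSpace_im_le 1)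
  have hSint : (interior S).Nonempty := by
    refine ⟨⟨0, 1 / 2⟩, mem_interior.2 ⟨{z | 0 < z.im} ∩ {z | z.im < 1}, ?_, ?_, ?_⟩⟩
    · exact fun z hz => ⟨hz.1.le, hz.2.le⟩
    · exact (isOpen_lt continuous_const continuous_im).inter
        (isOpen_lt continuous_im continuous_const)
    · constructor
      · change (0 : ℝ) < 1 / 2
        norm_num
      · change (1 / 2 : ℝ) < 1
        norm_num
  have hS := uniqueDiffOn_convex hSconv hSint
  let Θ : ℂ → ℂ := fun z => (z.re : ℂ) + ((z.im * η z.re : ℝ) : ℂ) * I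
  let Θ' : ℂ → ℂ →L[ℝ] ℂ := fun z =>
    ofRealCLM.comp reCLM +
      (ofRealCLM.comp (planeForm (z.im * η' z.re) (η z.re))).smulRight I
  have hre : ∀ z, (Θ z).re = z.re := fun z => by simp [Θ]
  have him : ∀ z, (Θ z).im = z.im * η z.re := fun z => by simp [Θ]
  have himage : Θ '' S = closedFluidDomain η := by
    ext z
    constructor
    · rintro ⟨w, hw, rfl⟩
      have h1 := hpos w.re
      have h2 := hw.1
      have h3 := hw.2
      refine ⟨?_, ?_⟩
      · rw [him]; positivity
      · rw [him, hre]; nlinarith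
    · intro hz
      have h1 := hpos z.re
      refine ⟨⟨z.re, z.im / η z.re⟩, ⟨div_nonneg hz.1 h1.le, (div_le_one h1).2 hz.2⟩, ?_⟩
      apply Complex.ext
      · rw [hre]
      · rw [him]; exact div_mul_cancel₀ _ h1.ne'
  have hderiv : ∀ z ∈ S, HasFDerivWithinAt Θ (Θ' z) S z := by
    intro z _
    have h1 : HasFDerivAt (fun w : ℂ => w.im * η w.re)
        (planeForm (z.im * η' z.re) (η z.re)) z := by
      have h2 : HasFDerivAt (fun w : ℂ => η w.re) (η' z.re • reCLM) z :=
        (hη z.re).comp_hasFDerivAt z reCLM.hasFDerivAt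
      have h3 : HasFDerivAt (fun w : ℂ => w.im) imCLM z := imCLM.hasFDerivAt
      refine (h3.mul h2).congr_fderiv ?_
      ext v
      simp
      ring
    have h4 : HasFDerivAt (fun w : ℂ => (w.re : ℂ)) (ofRealCLM.comp reCLM) z :=
      (ofRealCLM.comp reCLM).hasFDerivAt
    have h5 : HasFDerivAt (fun w : ℂ => ((w.im * η w.re : ℝ) : ℂ))
        (ofRealCLM.comp (planeForm (z.im * η' z.re) (η z.re))) z :=
      ofRealCLM.hasFDerivAt.comp z h1
    exact (h4.add (h5.mul_const' I)).hasFDerivWithinAt.congr_fderiv (by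
      ext v; simp [Θ', mul_comm])
  rw [← himage]
  refine hS.image hderiv fun z hz => Function.Surjective.denseRange fun w => ?_
  refine ⟨⟨w.re, (w.im - z.im * η' z.re * w.re) / η z.re⟩, ?_⟩
  have h1 := (hpos z.re).ne'
  apply Complex.ext
  · simp [Θ']
  · simp [Θ']
    field_simp
    ring

end Domain

/-! ### Derivatives of the wave up to the boundary -/

/-- The first and second derivatives of a steady wave, with the relations between them that hold
up to the boundary: `P = ψ_x`, `Q = ψ_y`, `a = ψ_xx = -ψ_yy`, `b = ψ_xy`. -/
structure FlowData (r : ℝ) (η η' : ℝ → ℝ) (ψ P Q a b : ℂ → ℝ) (N : ℝ) : Prop where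
  depth_pos : ∀ x, 0 < η x
  hasDerivAt_profile : ∀ x, HasDerivAt η (η' x) x
  slope_le : ∀ x, |η' x| ≤ N
  slope_lipschitz : ∀ x y, |η' x - η' y| ≤ N * |x - y|
  stream_le : ∀ z ∈ closedFluidDomain η, |ψ z| ≤ N
  P_le : ∀ z ∈ closedFluidDomain η, |P z| ≤ N
  Q_le : ∀ z ∈ closedFluidDomain η, |Q z| ≤ N
  a_le : ∀ z ∈ closedFluidDomain η, |a z| ≤ N
  b_le : ∀ z ∈ closedFluidDomain η, |b z| ≤ N
  hasFDerivWithinAt_stream : ∀ z ∈ closedFluidDomain η,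
    HasFDerivWithinAt ψ (planeForm (P z) (Q z)) (closedFluidDomain η) z
  hasFDerivWithinAt_P : ∀ z ∈ closedFluidDomain η,
    HasFDerivWithinAt P (planeForm (a z) (b z)) (closedFluidDomain η) z
  hasFDerivWithinAt_Q : ∀ z ∈ closedFluidDomain η,
    HasFDerivWithinAt Q (planeForm (b z) (-a z)) (closedFluidDomain η) z
  continuousOn_a : ContinuousOn a (closedFluidDomain η)
  continuousOn_b : ContinuousOn b (closedFluidDomain η)
  holomorphic : ∀ z ∈ fluidDomain η, DifferentiableAt ℂ (fun z => (P z : ℂ) - I * Q z) z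
  bernoulli : ∀ x, 1 / 2 * (P ⟨x, η x⟩ ^ 2 + Q ⟨x, η x⟩ ^ 2) + η x = r
  surface : ∀ x, ψ ⟨x, η x⟩ = 1
  bottom : ∀ x, ψ ⟨x, 0⟩ = 0
  Q_pos : ∀ z ∈ closedFluidDomain η, 0 < Q z

theorem hasDerivAt_mk_of_hasDerivAt {f g : ℝ → ℝ} {f' g' x : ℝ} (hf : HasDerivAt f f' x)
    (hg : HasDerivAt g g' x) : HasDerivAt (fun t => (⟨f t, g t⟩ : ℂ)) ⟨f', g'⟩ x := by
  have h := hf.ofReal_comp.add (hg.ofReal_comp.mul_const I)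
  simp only [mk_eq_add_mul_I]
  exact h

/-- The chain rule along a curve that stays in the set near the base point. -/
theorem HasFDerivWithinAt.comp_hasDerivAt_of_eventually_mem {s : Set ℂ} {f : ℂ → ℝ}
    {c : ℝ → ℂ} {c' : ℂ} {x α β : ℝ}
    (hf : HasFDerivWithinAt f (planeForm α β) s (c x)) (hc : HasDerivAt c c' x)
    (hmem : ∀ᶠ t in 𝓝 x, c t ∈ s) :
    HasDerivAt (fun t => f (c t)) (α * c'.re + β * c'.im) x := by
  have h := HasFDerivWithinAt.comp_hasDerivWithinAt (t := s) (s := c ⁻¹' s) x hf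
    hc.hasDerivWithinAt (fun t ht => ht)
  rw [planeForm_apply] at h
  exact h.hasDerivAt hmem

/-- Inside the fluid, `ψ_x - i ψ_y` is holomorphic and its Cauchy–Riemann equations relate the
second derivatives. These are continuous up to the boundary, so the relations persist there by
density of the interior. -/
theorem IsIrrotationalWave.exists_flowData {γ : ℝ≥0} {r : ℝ} {ψ : ℂ → ℝ} {η : ℝ → ℝ}
    (hw : IsIrrotationalWave γ r ψ η) :
    ∃ (η' : ℝ → ℝ) (a b : ℂ → ℝ) (N : ℝ),
      FlowData r η η' ψ (partialX η ψ) (partialY η ψ) a b N := by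
  obtain ⟨hη, ⟨M₁, hM₁⟩, -⟩ := hw.profile_regular
  obtain ⟨hψ, ⟨M₂, hM₂⟩, -⟩ := hw.stream_regular
  have hη2 : ContDiff ℝ 2 η := contDiffOn_univ.1 hη
  have hηd : ∀ x, HasDerivAt η (deriv η x) x := fun x =>
    (hη2.differentiable (by norm_num) x).hasDerivAt
  have hηc : Continuous η := hη2.continuous
  set Ω := closedFluidDomain η with hΩ
  have hU : UniqueDiffOn ℝ Ω := uniqueDiffOn_closedFluidDomain hw.depth_pos hηd
  set G : ℂ → ℂ →L[ℝ] ℝ := fderivWithin ℝ ψ Ω with hG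
  have hG1 : ContDiffOn ℝ 1 G Ω := hψ.fderivWithin hU (by norm_num)
  have hP1 : ContDiffOn ℝ 1 (partialX η ψ) Ω := hG1.clm_apply contDiffOn_const
  have hQ1 : ContDiffOn ℝ 1 (partialY η ψ) Ω := hG1.clm_apply contDiffOn_const
  have hGd : ∀ z ∈ Ω, HasFDerivWithinAt ψ (G z) Ω z := fun z hz =>
    (hψ.differentiableOn (by norm_num) z hz).hasFDerivWithinAt
  have hPd : ∀ z ∈ Ω, HasFDerivWithinAt (partialX η ψ) (fderivWithin ℝ (partialX η ψ) Ω z) Ω z :=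
    fun z hz => (hP1.differentiableOn (by norm_num) z hz).hasFDerivWithinAt
  have hQd : ∀ z ∈ Ω, HasFDerivWithinAt (partialY η ψ) (fderivWithin ℝ (partialY η ψ) Ω z) Ω z :=
    fun z hz => (hQ1.differentiableOn (by norm_num) z hz).hasFDerivWithinAt
  have hPc := hP1.continuousOn_fderivWithin hU (by norm_num)
  have hQc := hQ1.continuousOn_fderivWithin hU (by norm_num)
  have hhol : ∀ z ∈ fluidDomain η,
      DifferentiableAt ℂ (fun z => (partialX η ψ z : ℂ) - I * partialY η ψ z) z := by
    intro z hz
    refine (HarmonicAt.differentiableAt_complex_partial (hw.harmonic z hz)).congr_of_eventuallyEq ?_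
    filter_upwards [(isOpen_fluidDomain hηc).mem_nhds hz] with w hw'
    simp only [partialX, partialY, fderivWithin_of_mem_nhds (closedFluidDomain_mem_nhds hηc hw')]
  have hCR : ∀ z ∈ fluidDomain η,
      fderivWithin ℝ (partialY η ψ) Ω z 1 = fderivWithin ℝ (partialX η ψ) Ω z I ∧
      fderivWithin ℝ (partialY η ψ) Ω z I = - fderivWithin ℝ (partialX η ψ) Ω z 1 := by
    intro z hz
    have hn := closedFluidDomain_mem_nhds hηc hz
    have h1 := (hhol z hz).hasFDerivAt.restrictScalars ℝ
    have hP := reCLM.hasFDerivAt.comp z h1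
    have hQ := imCLM.hasFDerivAt.comp z h1
    have hP' := (hP.congr_of_eventuallyEq (f₁ := partialX η ψ)
      (Eventually.of_forall fun w => by simp)).fderiv
    have hQ' := (hQ.neg.congr_of_eventuallyEq (f₁ := partialY η ψ)
      (Eventually.of_forall fun w => by simp)).fderiv
    rw [← fderivWithin_of_mem_nhds hn] at hP' hQ'
    rw [hP', hQ']
    have hI : ∀ L : ℂ →L[ℂ] ℂ, L I = I * L 1 := fun L => by
      rw [← smul_eq_mul, ← map_smul]; simp
    constructor <;> simp [hI]
  have hsub : fluidDomain η ⊆ Ω := fluidDomain_subset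
  have hcl : Ω ⊆ closure (fluidDomain η) := closedFluidDomain_subset_closure hw.depth_pos
  have hCR1 : EqOn (fun z => fderivWithin ℝ (partialY η ψ) Ω z 1)
      (fun z => fderivWithin ℝ (partialX η ψ) Ω z I) Ω :=
    Set.EqOn.of_subset_closure (fun z hz => (hCR z hz).1) (hQc.clm_apply continuousOn_const)
      (hPc.clm_apply continuousOn_const) hsub hcl
  have hCR2 : EqOn (fun z => fderivWithin ℝ (partialY η ψ) Ω z I)
      (fun z => - fderivWithin ℝ (partialX η ψ) Ω z 1) Ω :=
    Set.EqOn.of_subset_closure (fun z hz => (hCR z hz).2) (hQc.clm_apply continuousOn_const)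
      (hPc.clm_apply continuousOn_const).neg hsub hcl
  have hGle : ∀ z ∈ Ω, ‖G z‖ ≤ M₂ := fun z hz => by
    have := hM₂ 1 (by norm_num) z hz
    rwa [norm_iteratedFDerivWithin_one _ (hU z hz)] at this
  have hGle' : ∀ z ∈ Ω, ‖fderivWithin ℝ G Ω z‖ ≤ M₂ := fun z hz => by
    have := hM₂ 2 le_rfl z hz
    rwa [← norm_iteratedFDerivWithin_fderivWithin hU hz,
      norm_iteratedFDerivWithin_one _ (hU z hz)] at this
  have hPG : ∀ z ∈ Ω, ∀ v, fderivWithin ℝ (partialX η ψ) Ω z v = fderivWithin ℝ G Ω z v 1 := by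
    intro z hz v
    have h1 := (hG1.differentiableOn (by norm_num) z hz).hasFDerivWithinAt
    have h2 := h1.clm_apply (hasFDerivWithinAt_const (1 : ℂ) z Ω)
    have h3 : fderivWithin ℝ (partialX η ψ) Ω z = _ := h2.fderivWithin (hU z hz)
    rw [h3]
    simp
  have hPle : ∀ z ∈ Ω, ∀ v, ‖v‖ = 1 → |fderivWithin ℝ (partialX η ψ) Ω z v| ≤ M₂ := by
    intro z hz v hv
    rw [hPG z hz v, ← Real.norm_eq_abs]
    have h1 := (fderivWithin ℝ G Ω z v).le_opNorm 1
    have h2 := (fderivWithin ℝ G Ω z).le_opNorm v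
    have h3 := hGle' z hz
    simp only [hv, norm_one, mul_one] at h1 h2
    linarith
  have hdη : ∀ x, ‖deriv (deriv η) x‖ ≤ M₁ := fun x => by
    have := hM₁ 2 le_rfl x (mem_univ x)
    rwa [iteratedFDerivWithin_univ, norm_iteratedFDeriv_eq_norm_iteratedDeriv, iteratedDeriv_succ,
      iteratedDeriv_one] at this
  refine ⟨deriv η, fun z => fderivWithin ℝ (partialX η ψ) Ω z 1,
    fun z => fderivWithin ℝ (partialX η ψ) Ω z I, max M₁ M₂, hw.depth_pos, hηd, ?_, ?_, ?_, ?_, ?_,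
    ?_, ?_, ?_, ?_, ?_, ?_, ?_, hhol, hw.bernoulli, hw.surface, hw.bottom, hw.unidirectional⟩
  · intro x
    refine le_trans ?_ (le_max_left _ _)
    have := hM₁ 1 (by norm_num) x (mem_univ x)
    rwa [iteratedFDerivWithin_univ, norm_iteratedFDeriv_eq_norm_iteratedDeriv,
      iteratedDeriv_one] at this
  · intro x y
    have hd : Differentiable ℝ (deriv η) :=
      ((contDiff_succ_iff_deriv (n := 1)).1 (by rw [one_add_one_eq_two]; exact hη2)).2.2.differentiable (by norm_num)
    have := convex_univ.norm_image_sub_le_of_norm_deriv_le (f := deriv η) (C := max M₁ M₂)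
      (fun x _ => hd x) (fun x _ => (hdη x).trans (le_max_left _ _)) (mem_univ y) (mem_univ x)
    simpa using this
  · intro z hz
    refine le_trans ?_ (le_max_right _ _)
    have := hM₂ 0 (by norm_num) z hz
    rwa [norm_iteratedFDerivWithin_zero] at this
  · intro z hz
    refine le_trans ?_ ((hGle z hz).trans (le_max_right _ _))
    have := (G z).le_opNorm 1
    rwa [norm_one, mul_one] at this
  · intro z hz
    refine le_trans ?_ ((hGle z hz).trans (le_max_right _ _))
    have := (G z).le_opNorm I
    rwa [norm_I, mul_one] at this
  · exact fun z hz => (hPle z hz 1 (by simp)).trans (le_max_right _ _)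
  · exact fun z hz => (hPle z hz I (by simp)).trans (le_max_right _ _)
  · intro z hz
    exact (hGd z hz).congr_fderiv (eq_planeForm _)
  · intro z hz
    exact (hPd z hz).congr_fderiv (eq_planeForm _)
  · intro z hz
    refine (hQd z hz).congr_fderiv ((eq_planeForm _).trans ?_)
    congr 1
    exacts [hCR1 hz, hCR2 hz]
  · exact hPc.clm_apply continuousOn_const
  · exact hPc.clm_apply continuousOn_const

theorem HasConjGradAt.of_partial {g : ℂ → ℝ} {V w : ℂ}
    (hx : HasDerivAt (fun x => g ⟨x, w.im⟩) V.re w.re)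
    (hy : HasDerivAt (fun y => g ⟨w.re, y⟩) (-V.im) w.im) : HasConjGradAt g V w := by
  constructor
  · have h0 : HasDerivAt (fun t : ℝ => w.re + t) 1 0 := (hasDerivAt_id 0).const_add _
    have h1 : HasDerivAt (fun x => g ⟨x, w.im⟩) V.re (w.re + 0) := by rwa [add_zero]
    have h2 := HasDerivAt.comp (h := fun t : ℝ => w.re + t) 0 h1 h0
    rw [mul_one] at h2
    refine h2.congr_of_eventuallyEq (Eventually.of_forall fun t => ?_)
    simp only [Function.comp]
    congr 1
    apply Complex.ext <;> simp
  · have h0 : HasDerivAt (fun t : ℝ => w.im + t) 1 0 := (hasDerivAt_id 0).const_add _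
    have h1 : HasDerivAt (fun y => g ⟨w.re, y⟩) (-V.im) (w.im + 0) := by rwa [add_zero]
    have h2 := HasDerivAt.comp (h := fun t : ℝ => w.im + t) 0 h1 h0
    rw [mul_one] at h2
    refine h2.congr_of_eventuallyEq (Eventually.of_forall fun t => ?_)
    simp only [Function.comp]
    congr 1
    apply Complex.ext <;> simp

theorem HasFDerivWithinAt.hasConjGradAt {f : ℂ → ℝ} {s : Set ℂ} {z : ℂ} {α β : ℝ}
    (hf : HasFDerivWithinAt f (planeForm α β) s z) (hs : s ∈ 𝓝 z) :
    HasConjGradAt f (α - I * β) z := by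
  have h := hf.hasFDerivAt hs
  have hf' : HasFDerivWithinAt f (planeForm α β) univ z := h.hasFDerivWithinAt
  refine HasConjGradAt.of_partial ?_ ?_
  · have := HasFDerivWithinAt.comp_hasDerivAt_of_eventually_mem (c := fun x : ℝ => ⟨x, z.im⟩)
      (x := z.re) hf' (hasDerivAt_mk_of_hasDerivAt (hasDerivAt_id _) (hasDerivAt_const _ _))
      (by simp)
    simpa using this
  · have := HasFDerivWithinAt.comp_hasDerivAt_of_eventually_mem (c := fun y : ℝ => ⟨z.re, y⟩)
      (x := z.im) hf' (hasDerivAt_mk_of_hasDerivAt (hasDerivAt_const _ _) (hasDerivAt_id _))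
      (by simp)
    simpa using this

/-! ### Flux potential and flow force -/

/-- The vertical projection of the plane onto the closed fluid domain. -/
noncomputable def verticalClamp (η : ℝ → ℝ) (z : ℂ) : ℂ := ⟨z.re, max 0 (min z.im (η z.re))⟩

/-- The primitive `∫₀^y ½ (ψ_y² - ψ_x²) dt` of the dynamic part of the flow force density. -/
noncomputable def fluxPotential (η : ℝ → ℝ) (P Q : ℂ → ℝ) (z : ℂ) : ℝ :=
  ∫ t in (0 : ℝ)..z.im,
    (Q (verticalClamp η ⟨z.re, t⟩) ^ 2 - P (verticalClamp η ⟨z.re, t⟩) ^ 2) / 2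

theorem continuous_mk {X : Type*} [TopologicalSpace X] {f g : X → ℝ} (hf : Continuous f)
    (hg : Continuous g) : Continuous fun t => (⟨f t, g t⟩ : ℂ) := by
  simp only [mk_eq_add_mul_I]
  fun_prop

theorem verticalClamp_eq {η : ℝ → ℝ} {z : ℂ} (hz : z ∈ closedFluidDomain η) :
    verticalClamp η z = z := by
  apply Complex.ext
  · rfl
  · simp only [verticalClamp]
    rw [min_eq_left hz.2, max_eq_right hz.1]

namespace FlowData

variable {r N : ℝ} {η η' : ℝ → ℝ} {ψ P Q a b : ℂ → ℝ} (h : FlowData r η η' ψ P Q a b N)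

include h

theorem continuous_profile : Continuous η :=
  continuous_iff_continuousAt.2 fun x => (h.hasDerivAt_profile x).continuousAt

theorem isClosed : IsClosed (closedFluidDomain η) :=
  isClosed_closedFluidDomain h.continuous_profile

theorem top_mem (x : ℝ) : (⟨x, η x⟩ : ℂ) ∈ closedFluidDomain η := ⟨(h.depth_pos x).le, le_rfl⟩

theorem bottom_mem (x : ℝ) : (⟨x, 0⟩ : ℂ) ∈ closedFluidDomain η := ⟨le_rfl, (h.depth_pos x).le⟩

theorem bound_pos : 0 < N :=
  (h.Q_pos _ (h.bottom_mem 0)).trans_le ((le_abs_self _).trans (h.Q_le _ (h.bottom_mem 0)))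

theorem profile_lt (x : ℝ) : η x < r := by
  have h1 := h.bernoulli x
  have h2 := h.Q_pos _ (h.top_mem x)
  nlinarith [sq_nonneg (P ⟨x, η x⟩), pow_pos h2 2]

theorem energy_pos : 0 < r := (h.depth_pos 0).trans (h.profile_lt 0)

theorem mem_strip (z : ℂ) (hz : z ∈ closedFluidDomain η) : 0 ≤ z.im ∧ z.im ≤ r :=
  ⟨hz.1, hz.2.trans (h.profile_lt _).le⟩

theorem continuousOn_stream : ContinuousOn ψ (closedFluidDomain η) :=
  fun z hz => (h.hasFDerivWithinAt_stream z hz).continuousWithinAt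

theorem continuousOn_P : ContinuousOn P (closedFluidDomain η) :=
  fun z hz => (h.hasFDerivWithinAt_P z hz).continuousWithinAt

theorem continuousOn_Q : ContinuousOn Q (closedFluidDomain η) :=
  fun z hz => (h.hasFDerivWithinAt_Q z hz).continuousWithinAt

theorem surface_kinematic (x : ℝ) : P ⟨x, η x⟩ + Q ⟨x, η x⟩ * η' x = 0 := by
  have h1 := HasFDerivWithinAt.comp_hasDerivAt_of_eventually_mem (c := fun x : ℝ => ⟨x, η x⟩)
    (x := x) (h.hasFDerivWithinAt_stream _ (h.top_mem x))
    (hasDerivAt_mk_of_hasDerivAt (hasDerivAt_id _) (h.hasDerivAt_profile x))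
    (Eventually.of_forall h.top_mem)
  simp only [h.surface] at h1
  simpa using h1.unique (hasDerivAt_const x (1 : ℝ))

theorem P_bottom (x : ℝ) : P ⟨x, 0⟩ = 0 := by
  have h1 := HasFDerivWithinAt.comp_hasDerivAt_of_eventually_mem (c := fun x : ℝ => ⟨x, 0⟩)
    (x := x) (h.hasFDerivWithinAt_stream _ (h.bottom_mem x))
    (hasDerivAt_mk_of_hasDerivAt (hasDerivAt_id _) (hasDerivAt_const _ _))
    (Eventually.of_forall h.bottom_mem)
  simp only [h.bottom] at h1
  simpa using h1.unique (hasDerivAt_const x (0 : ℝ))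

theorem a_bottom (x : ℝ) : a ⟨x, 0⟩ = 0 := by
  have h1 := HasFDerivWithinAt.comp_hasDerivAt_of_eventually_mem (c := fun x : ℝ => ⟨x, 0⟩)
    (x := x) (h.hasFDerivWithinAt_P _ (h.bottom_mem x))
    (hasDerivAt_mk_of_hasDerivAt (hasDerivAt_id _) (hasDerivAt_const _ _))
    (Eventually.of_forall h.bottom_mem)
  simp only [h.P_bottom] at h1
  simpa using h1.unique (hasDerivAt_const x (0 : ℝ))

omit h in
theorem _root_.HasFDerivWithinAt.hasDerivWithinAt_vertical {f : ℂ → ℝ} {x y α β : ℝ}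
    (hf : HasFDerivWithinAt f (planeForm α β) (closedFluidDomain η) ⟨x, y⟩) :
    HasDerivWithinAt (fun t => f ⟨x, t⟩) β (Icc 0 (η x)) y := by
  have hc : HasDerivAt (fun t : ℝ => (⟨x, t⟩ : ℂ)) ⟨0, 1⟩ y :=
    hasDerivAt_mk_of_hasDerivAt (hasDerivAt_const _ _) (hasDerivAt_id _)
  have := HasFDerivWithinAt.comp_hasDerivWithinAt (t := closedFluidDomain η)
    (f := fun t : ℝ => (⟨x, t⟩ : ℂ)) (s := Icc 0 (η x)) y hf
    hc.hasDerivWithinAt (fun t ht => ht)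
  rw [planeForm_apply] at this
  simpa [Function.comp_def] using! this

/-- Over the depth `η x` the stream function rises from `0` to `1` with slope at most `N`. The
resulting uniform lower bound on the depth makes `inf η` positive and gives room for small vertical
steps below the surface. -/
theorem one_le_bound_mul_profile (x : ℝ) : 1 ≤ N * η x := by
  have h1 := (convex_Icc 0 (η x)).norm_image_sub_le_of_norm_hasDerivWithin_le (C := N)
    (f := fun t => ψ ⟨x, t⟩) (f' := fun t => Q ⟨x, t⟩)
    (fun t ht => (h.hasFDerivWithinAt_stream ⟨x, t⟩ ht).hasDerivWithinAt_vertical)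
    (fun t ht => h.Q_le ⟨x, t⟩ ht) (left_mem_Icc.2 (h.depth_pos x).le)
    (right_mem_Icc.2 (h.depth_pos x).le)
  rw [h.surface, h.bottom] at h1
  simpa [abs_of_pos (h.depth_pos x)] using h1

theorem hasConjGradAt_stream {z : ℂ} (hz : z ∈ fluidDomain η) :
    HasConjGradAt ψ (P z - I * Q z) z :=
  (h.hasFDerivWithinAt_stream z (fluidDomain_subset hz)).hasConjGradAt
    (closedFluidDomain_mem_nhds h.continuous_profile hz)

theorem hasFDerivWithinAt_momentum {z : ℂ} (hz : z ∈ closedFluidDomain η) :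
    HasFDerivWithinAt (fun z => (Q z ^ 2 - P z ^ 2) / 2)
      (planeForm (Q z * b z - P z * a z) (-(Q z * a z + P z * b z)))
      (closedFluidDomain η) z := by
  have hP := h.hasFDerivWithinAt_P z hz
  have hQ := h.hasFDerivWithinAt_Q z hz
  refine (((hQ.pow 2).sub (hP.pow 2)).mul_const (2⁻¹ : ℝ)).congr_fderiv ?_
  ext v
  simp
  ring

theorem hasFDerivWithinAt_shear {z : ℂ} (hz : z ∈ closedFluidDomain η) :
    HasFDerivWithinAt (fun z => P z * Q z)
      (planeForm (Q z * a z + P z * b z) (Q z * b z - P z * a z))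
      (closedFluidDomain η) z := by
  have hP := h.hasFDerivWithinAt_P z hz
  have hQ := h.hasFDerivWithinAt_Q z hz
  refine (hP.mul hQ).congr_fderiv ?_
  ext v
  simp
  ring

theorem continuous_verticalClamp : Continuous (verticalClamp η) :=
  continuous_mk continuous_re (continuous_const.max
    (continuous_im.min (h.continuous_profile.comp continuous_re)))

theorem verticalClamp_mem (z : ℂ) : verticalClamp η z ∈ closedFluidDomain η :=
  ⟨le_max_left _ _, max_le (h.depth_pos _).le (min_le_right _ _)⟩

/-- Clamping extends the integrand continuously to the whole plane, so that `fluxPotential` is a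
continuous parametric integral everywhere. -/
theorem continuous_momentum_clamp : Continuous fun z =>
    (Q (verticalClamp η z) ^ 2 - P (verticalClamp η z) ^ 2) / 2 := by
  have hP := h.continuousOn_P.comp_continuous h.continuous_verticalClamp h.verticalClamp_mem
  have hQ := h.continuousOn_Q.comp_continuous h.continuous_verticalClamp h.verticalClamp_mem
  exact ((hQ.pow 2).sub (hP.pow 2)).div_const 2

theorem continuous_fluxPotential : Continuous (fluxPotential η P Q) := by
  refine intervalIntegral.continuous_parametric_intervalIntegral_of_continuous (X := ℂ)
    (f := fun z t => (Q (verticalClamp η ⟨z.re, t⟩) ^ 2 - P (verticalClamp η ⟨z.re, t⟩) ^ 2) / 2)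
    ?_ continuous_im
  exact h.continuous_momentum_clamp.comp
    (continuous_mk (continuous_re.comp continuous_fst) continuous_snd)

omit h in
theorem fluxPotential_bottom (x : ℝ) : fluxPotential η P Q ⟨x, 0⟩ = 0 := by
  simp [fluxPotential]

theorem hasDerivAt_fluxPotential_vertical {x y : ℝ} (hy : (⟨x, y⟩ : ℂ) ∈ closedFluidDomain η) :
    HasDerivAt (fun t => fluxPotential η P Q ⟨x, t⟩) ((Q ⟨x, y⟩ ^ 2 - P ⟨x, y⟩ ^ 2) / 2) y := by
  have hc : Continuous fun t : ℝ =>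
      (Q (verticalClamp η ⟨x, t⟩) ^ 2 - P (verticalClamp η ⟨x, t⟩) ^ 2) / 2 :=
    h.continuous_momentum_clamp.comp (continuous_mk continuous_const continuous_id)
  have := intervalIntegral.integral_hasDerivAt_right (hc.intervalIntegrable 0 y)
    (hc.stronglyMeasurableAtFilter _ _) hc.continuousAt
  rw [verticalClamp_eq hy] at this
  exact this

/-- The derivative of the flux potential along a curve in the closed fluid domain. -/
theorem hasDerivAt_fluxPotential_curve {l l' : ℝ → ℝ} {x₀ : ℝ} {s : Set ℝ} (hs : s ∈ 𝓝 x₀)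
    (hl : ∀ x ∈ s, HasDerivAt l (l' x) x) (hl' : ∀ x ∈ s, |l' x| ≤ N)
    (hmem : ∀ x ∈ s, (⟨x, l x⟩ : ℂ) ∈ closedFluidDomain η) :
    HasDerivAt (fun x => fluxPotential η P Q ⟨x, l x⟩)
      (P ⟨x₀, l x₀⟩ * Q ⟨x₀, l x₀⟩ +
        l' x₀ * ((Q ⟨x₀, l x₀⟩ ^ 2 - P ⟨x₀, l x₀⟩ ^ 2) / 2)) x₀ := by
  have hx₀ : x₀ ∈ s := mem_of_mem_nhds hs
  obtain ⟨u, hus, huo, hxu⟩ := mem_nhds_iff.1 hs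
  have hu : u ∈ 𝓝 x₀ := huo.mem_nhds hxu
  set F : ℂ → ℝ := fun z => (Q z ^ 2 - P z ^ 2) / 2 with hF
  set c : ℂ → ℝ := fun z => Q z * b z - P z * a z with hc
  set d : ℂ → ℝ := fun z => Q z * a z + P z * b z with hd
  have hN := h.bound_pos
  have hcurve : ∀ x ∈ s, ∀ t ∈ Icc (0 : ℝ) 1, (⟨x, l x * t⟩ : ℂ) ∈ closedFluidDomain η := by
    intro x hx t ht
    have h1 := hmem x hx
    exact ⟨mul_nonneg h1.1 ht.1, (mul_le_of_le_one_right h1.1 ht.2).trans h1.2⟩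
  have hFcont : ContinuousOn F (closedFluidDomain η) := fun z hz =>
    (h.hasFDerivWithinAt_momentum hz).continuousWithinAt
  have hccont : ContinuousOn c (closedFluidDomain η) :=
    (h.continuousOn_Q.mul h.continuousOn_b).sub (h.continuousOn_P.mul h.continuousOn_a)
  have hdcont : ContinuousOn d (closedFluidDomain η) :=
    (h.continuousOn_Q.mul h.continuousOn_a).add (h.continuousOn_P.mul h.continuousOn_b)
  have hcurvec : ∀ x, ContinuousOn (fun t : ℝ => (⟨x, l x * t⟩ : ℂ)) (Icc 0 1) := fun x =>
    (continuous_mk continuous_const (continuous_const.mul continuous_id)).continuousOn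
  -- Rescaling `y = l(x) t` fixes the interval of integration to `[0, 1]`, so one can differentiate
  -- under the integral sign.
  set G : ℝ → ℝ → ℝ := fun x t => l x * F ⟨x, l x * t⟩ with hG
  set G' : ℝ → ℝ → ℝ := fun x t => l' x * F ⟨x, l x * t⟩ +
    l x * (c ⟨x, l x * t⟩ * 1 + -d ⟨x, l x * t⟩ * (l' x * t)) with hG'
  have hGcont : ∀ x ∈ s, ContinuousOn (G x) (Icc 0 1) := fun x hx =>
    continuousOn_const.mul (hFcont.comp (hcurvec x) (hcurve x hx))
  have hG'cont : ∀ x ∈ s, ContinuousOn (G' x) (Icc 0 1) := fun x hx =>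
    (continuousOn_const.mul (hFcont.comp (hcurvec x) (hcurve x hx))).add
      (continuousOn_const.mul (((hccont.comp (hcurvec x) (hcurve x hx)).mul continuousOn_const).add
        ((hdcont.comp (hcurvec x) (hcurve x hx)).neg.mul
          (continuousOn_const.mul continuousOn_id))))
  have huIoc : uIoc (0 : ℝ) 1 ⊆ Icc 0 1 := by
    rw [uIoc_of_le zero_le_one]
    exact Ioc_subset_Icc_self
  have hint : ∀ x ∈ s, ∫ t in (0 : ℝ)..1, G x t = fluxPotential η P Q ⟨x, l x⟩ := by
    intro x hx
    have h1 : ∫ t in (0 : ℝ)..1, G x t = l x * ∫ t in (0 : ℝ)..1, F ⟨x, l x * t⟩ :=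
      intervalIntegral.integral_const_mul _ _
    rw [h1, intervalIntegral.mul_integral_comp_mul_left (f := fun t => F ⟨x, t⟩) (c := l x),
      mul_zero, mul_one]
    have h2 := hmem x hx
    refine intervalIntegral.integral_congr fun t ht => ?_
    rw [uIcc_of_le h2.1] at ht
    have h3 : (⟨x, t⟩ : ℂ) ∈ closedFluidDomain η := ⟨ht.1, ht.2.trans h2.2⟩
    simp only [verticalClamp_eq h3, hF]
  have habs : ∀ p q : ℝ, |p| ≤ N → |q| ≤ N → |p * q| ≤ N * N := fun p q hp hq => by
    rw [abs_mul]
    exact mul_le_mul hp hq (abs_nonneg _) hN.le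
  have hcle : ∀ z ∈ closedFluidDomain η, |c z| ≤ 2 * (N * N) := fun z hz => by
    have h1 := habs _ _ (h.Q_le z hz) (h.b_le z hz)
    have h2 := habs _ _ (h.P_le z hz) (h.a_le z hz)
    have h3 := abs_sub (Q z * b z) (P z * a z)
    simp only [hc]
    linarith
  have hdle : ∀ z ∈ closedFluidDomain η, |d z| ≤ 2 * (N * N) := fun z hz => by
    have h1 := habs _ _ (h.Q_le z hz) (h.a_le z hz)
    have h2 := habs _ _ (h.P_le z hz) (h.b_le z hz)
    have h3 := abs_add_le (Q z * a z) (P z * b z)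
    simp only [hd]
    linarith
  have hFle : ∀ z ∈ closedFluidDomain η, |F z| ≤ N * N := fun z hz => by
    have h1 := abs_le.1 (h.Q_le z hz)
    have h2 := abs_le.1 (h.P_le z hz)
    rw [abs_le]
    constructor
    · simp only [hF]; nlinarith
    · simp only [hF]; nlinarith
  have key := intervalIntegral.hasDerivAt_integral_of_dominated_loc_of_deriv_le
    (μ := MeasureTheory.volume) (a := (0 : ℝ)) (b := 1) (F := G) (F' := G') (x₀ := x₀) (s := u)
    (bound := fun _ => N * (N * N) + r * (2 * (N * N) + 2 * (N * N) * N)) hu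
    (by
      filter_upwards [hs] with x hx
      exact ((hGcont x hx).mono huIoc).aestronglyMeasurable measurableSet_uIoc)
    ((hGcont x₀ hx₀).intervalIntegrable_of_Icc zero_le_one)
    (((hG'cont x₀ hx₀).mono huIoc).aestronglyMeasurable measurableSet_uIoc)
    (by
      refine Eventually.of_forall fun t ht x hx => ?_
      have ht' := huIoc ht
      have hz := hcurve x (hus hx) t ht'
      have h1 := hFle _ hz
      have h2 := hcle _ hz
      have h3 := hdle _ hz
      have h4 := hl' x (hus hx)
      have h5 : |l x| ≤ r := by
        rw [abs_of_nonneg (hmem x (hus hx)).1]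
        exact (h.mem_strip _ (hmem x (hus hx))).2
      have h6 : |l' x * t| ≤ N := by
        rw [abs_mul, abs_of_nonneg ht'.1]
        exact (mul_le_of_le_one_right (abs_nonneg _) ht'.2).trans h4
      simp only [hG', Real.norm_eq_abs, mul_one]
      refine (abs_add_le _ _).trans (add_le_add ?_ ?_)
      · rw [abs_mul]
        exact mul_le_mul h4 h1 (abs_nonneg _) hN.le
      · rw [abs_mul]
        refine mul_le_mul h5 ((abs_add_le _ _).trans (add_le_add h2 ?_)) (abs_nonneg _)
          h.energy_pos.le
        rw [abs_mul, abs_neg]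
        exact mul_le_mul h3 h6 (abs_nonneg _) (by positivity))
    intervalIntegrable_const
    (by
      refine Eventually.of_forall fun t ht x hx => ?_
      have ht' := huIoc ht
      have hcd := hasDerivAt_mk_of_hasDerivAt (hasDerivAt_id x)
        ((hl x (hus hx)).mul_const t)
      have hFd := HasFDerivWithinAt.comp_hasDerivAt_of_eventually_mem
        (c := fun x : ℝ => ⟨x, l x * t⟩)
        (h.hasFDerivWithinAt_momentum (hcurve x (hus hx) t ht')) hcd
        (by
          filter_upwards [huo.mem_nhds hx] with x hx
          exact hcurve x (hus hx) t ht')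
      exact (hl x (hus hx)).mul hFd)
  -- Momentum conservation, `F_x = (P Q)_y` and `F_y = -(P Q)_x`, makes `G'` an exact derivative in
  -- `t`. The contribution of the lower endpoint vanishes because `P = 0` on the bottom.
  have hFTC : ∫ t in (0 : ℝ)..1, G' x₀ t =
      P ⟨x₀, l x₀⟩ * Q ⟨x₀, l x₀⟩ + l' x₀ * F ⟨x₀, l x₀⟩ := by
    set E : ℝ → ℝ := fun t => P ⟨x₀, l x₀ * t⟩ * Q ⟨x₀, l x₀ * t⟩ +
      l' x₀ * t * F ⟨x₀, l x₀ * t⟩ with hE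
    have hEcont : ContinuousOn E (Icc 0 1) :=
      ((h.continuousOn_P.comp (hcurvec x₀) (hcurve x₀ hx₀)).mul
        (h.continuousOn_Q.comp (hcurvec x₀) (hcurve x₀ hx₀))).add
        ((continuousOn_const.mul continuousOn_id).mul
          (hFcont.comp (hcurvec x₀) (hcurve x₀ hx₀)))
    have hEd : ∀ t ∈ Ioo (0 : ℝ) 1, HasDerivAt E (G' x₀ t) t := by
      intro t ht
      have hz := hcurve x₀ hx₀ t (Ioo_subset_Icc_self ht)
      have hcd : HasDerivAt (fun t : ℝ => (⟨x₀, l x₀ * t⟩ : ℂ)) ⟨0, l x₀ * 1⟩ t :=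
        hasDerivAt_mk_of_hasDerivAt (hasDerivAt_const t x₀)
          ((hasDerivAt_id t).const_mul (l x₀))
      have hev : ∀ᶠ t in 𝓝 t, (⟨x₀, l x₀ * t⟩ : ℂ) ∈ closedFluidDomain η := by
        filter_upwards [Icc_mem_nhds ht.1 ht.2] with t ht
        exact hcurve x₀ hx₀ t ht
      have h1 := HasFDerivWithinAt.comp_hasDerivAt_of_eventually_mem
        (c := fun t : ℝ => ⟨x₀, l x₀ * t⟩) (h.hasFDerivWithinAt_shear hz) hcd hev
      have h2 := HasFDerivWithinAt.comp_hasDerivAt_of_eventually_mem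
        (c := fun t : ℝ => ⟨x₀, l x₀ * t⟩) (h.hasFDerivWithinAt_momentum hz) hcd hev
      refine (h1.add (((hasDerivAt_id t).const_mul (l' x₀)).mul h2)).congr_deriv ?_
      simp only [hG', hc, hd, hF, id]
      ring
    rw [intervalIntegral.integral_eq_sub_of_hasDerivAt_of_le zero_le_one hEcont hEd
      ((hG'cont x₀ hx₀).intervalIntegrable_of_Icc zero_le_one)]
    simp [hE, h.P_bottom]
  rw [← hFTC]
  refine key.2.congr_of_eventuallyEq ?_
  filter_upwards [hs] with x hx
  exact (hint x hx).symm

/-- The conjugate gradient is `i / 2` times the square of the holomorphic function `ψ_x - i ψ_y`,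
hence holomorphic. This is what makes the flux potential harmonic. -/
theorem hasConjGradAt_fluxPotential {z : ℂ} (hz : z ∈ fluidDomain η) :
    HasConjGradAt (fluxPotential η P Q) (I / 2 * (P z - I * Q z) ^ 2) z := by
  have hV : I / 2 * ((P z : ℂ) - I * Q z) ^ 2 =
      ((P z * Q z : ℝ) : ℂ) - I * (((Q z ^ 2 - P z ^ 2) / 2 : ℝ) : ℂ) := by
    push_cast
    linear_combination (-(P z : ℂ) * Q z + I / 2 * (Q z : ℂ) ^ 2) * I_sq
  rw [hV]
  refine HasConjGradAt.of_partial ?_ ?_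
  · have h1 := h.hasDerivAt_fluxPotential_curve (l := fun _ => z.im) (l' := fun _ => 0)
      (x₀ := z.re) (s := {x | z.im < η x})
      ((isOpen_lt continuous_const h.continuous_profile).mem_nhds hz.2)
      (fun x _ => hasDerivAt_const _ _) (fun x _ => by simpa using h.bound_pos.le)
      (fun x hx => ⟨hz.1.le, le_of_lt hx⟩)
    refine h1.congr_deriv ?_
    simp only [sub_re, mul_re, I_re, I_im, ofReal_re, ofReal_im]
    ring
  · refine (h.hasDerivAt_fluxPotential_vertical (fluidDomain_subset hz)).congr_deriv ?_
    simp only [sub_im, mul_im, I_re, I_im, ofReal_re, ofReal_im]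
    ring

/-- The flow force is constant along the wave. -/
theorem exists_flowForce : ∃ S : ℝ, ∀ x,
    fluxPotential η P Q ⟨x, η x⟩ = S - (r * η x - η x ^ 2 / 2) := by
  set T : ℝ → ℝ := fun x => fluxPotential η P Q ⟨x, η x⟩ + (r * η x - η x ^ 2 / 2) with hT
  have hd : ∀ x, HasDerivAt T 0 x := by
    intro x
    have h1 := h.hasDerivAt_fluxPotential_curve (l := η) (l' := η') (x₀ := x) (s := univ)
      univ_mem (fun x _ => h.hasDerivAt_profile x) (fun x _ => h.slope_le x)
      (fun x _ => h.top_mem x)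
    have h2 := h.hasDerivAt_profile x
    refine (h1.add ((h2.const_mul r).sub ((h2.pow 2).div_const 2))).congr_deriv ?_
    have h3 := h.bernoulli x
    have h4 := h.surface_kinematic x
    simp only [Nat.cast_ofNat, Nat.add_one_sub_one, pow_one]
    -- Bernoulli's law replaces `r - η` by `(P² + Q²) / 2`; the derivative becomes `Q (P + Q η')`,
    -- which is zero since the surface is a streamline.
    linear_combination Q ⟨x, η x⟩ * h4 - η' x * h3
  refine ⟨T 0, fun x => ?_⟩
  have := is_const_of_deriv_eq_zero (fun x => (hd x).differentiableAt) (fun x => (hd x).deriv) 0 x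
  rw [this]
  simp only [hT]
  ring

end FlowData

/-! ### Comparison principles and the lower bound for the bottom velocity -/

/-- A function on `[0, L]` that is minimal at `0` has nonnegative one-sided derivative there. -/
theorem HasDerivWithinAt.nonneg_of_forall_le {φ : ℝ → ℝ} {c L : ℝ} (hL : 0 < L)
    (hφ : HasDerivWithinAt φ c (Icc 0 L) 0) (hmin : ∀ t ∈ Icc 0 L, φ 0 ≤ φ t) : 0 ≤ c := by
  have h1 : HasDerivWithinAt φ c (Ioi 0) 0 :=
    hφ.mono_of_mem_nhdsWithin (Icc_mem_nhdsGT hL)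
  have h2 := (hasDerivWithinAt_iff_tendsto_slope' (by simp)).1 h1
  refine ge_of_tendsto h2 ?_
  filter_upwards [Ioc_mem_nhdsGT hL] with t ht
  rw [slope_def_field]
  exact div_nonneg (sub_nonneg.2 (hmin t (Ioc_subset_Icc_self ht))) (by linarith [ht.1])

namespace FlowData

variable {r N : ℝ} {η η' : ℝ → ℝ} {ψ P Q a b : ℂ → ℝ} (h : FlowData r η η' ψ P Q a b N)

include h

theorem abs_fluxPotential_le {z : ℂ} (hz : z ∈ closedFluidDomain η) :
    |fluxPotential η P Q z| ≤ N ^ 2 * r := by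
  have h1 := intervalIntegral.norm_integral_le_of_norm_le_const (a := 0) (b := z.im) (C := N ^ 2)
    (f := fun t => (Q (verticalClamp η ⟨z.re, t⟩) ^ 2 - P (verticalClamp η ⟨z.re, t⟩) ^ 2) / 2)
    (fun t _ => by
      have h1 := abs_le.1 (h.Q_le _ (h.verticalClamp_mem ⟨z.re, t⟩))
      have h2 := abs_le.1 (h.P_le _ (h.verticalClamp_mem ⟨z.re, t⟩))
      rw [Real.norm_eq_abs, abs_le]
      constructor <;> nlinarith)
  refine h1.trans (mul_le_mul_of_nonneg_left ?_ (sq_nonneg N))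
  rw [sub_zero, abs_of_nonneg hz.1]
  exact (h.mem_strip z hz).2

/-- The maximum principle in the fluid domain. -/
theorem max_principle {f : ℂ → ℝ} (hf : ContinuousOn f (closedFluidDomain η)) {M : ℝ}
    (hM : ∀ z ∈ closedFluidDomain η, f z ≤ M) (htop : ∀ x, f ⟨x, η x⟩ ≤ 0)
    (hbot : ∀ x, f ⟨x, 0⟩ ≤ 0)
    (hin : ∀ z ∈ fluidDomain η, ∃ (g : ℂ → ℝ) (V : ℂ → ℂ), DifferentiableAt ℂ V z ∧
      (∀ᶠ w in 𝓝 z, HasConjGradAt g (V w) w) ∧ (∀ᶠ w in 𝓝 z, g w ≤ f w) ∧ g z = f z) :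
    ∀ z ∈ closedFluidDomain η, f z ≤ 0 := by
  refine nonpos_of_touching h.isClosed h.mem_strip hf hM fun z hz hpos => ?_
  have hz' : z ∈ fluidDomain η := by
    refine ⟨lt_of_le_of_ne hz.1 fun h0 => ?_, lt_of_le_of_ne hz.2 fun h0 => ?_⟩
    · have := hbot z.re
      rw [h0, eta] at this
      linarith
    · have := htop z.re
      rw [← h0, eta] at this
      linarith
  exact ⟨closedFluidDomain_mem_nhds h.continuous_profile hz', hin z hz'⟩

theorem eventually_mem {z : ℂ} (hz : z ∈ fluidDomain η) : ∀ᶠ w in 𝓝 z, w ∈ fluidDomain η :=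
  (isOpen_fluidDomain h.continuous_profile).mem_nhds hz

/-- The maximum principle for a combination of the stream function, the flux potential and a
quadratic function of the height. -/
theorem combination_nonpos {α β δ c : ℝ} (hc : 0 ≤ c)
    (htop : ∀ x, α * ψ ⟨x, η x⟩ + β * fluxPotential η P Q ⟨x, η x⟩ + δ * η x
      + c * η x ^ 2 ≤ 0) :
    ∀ z ∈ closedFluidDomain η,
      α * ψ z + β * fluxPotential η P Q z + δ * z.im + c * z.im ^ 2 ≤ 0 := by
  have hcont : ContinuousOn (fun z : ℂ => α * ψ z + β * fluxPotential η P Q z + δ * z.im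
      + c * z.im ^ 2) (closedFluidDomain η) :=
    (((continuousOn_const.mul h.continuousOn_stream).add
      (continuousOn_const.mul h.continuous_fluxPotential.continuousOn)).add
      (continuousOn_const.mul continuous_im.continuousOn)).add
      (continuousOn_const.mul (continuous_im.continuousOn.pow 2))
  refine h.max_principle hcont (M := |α| * N + |β| * (N ^ 2 * r) + |δ| * r + c * r ^ 2)
    ?_ htop ?_ ?_
  · intro z hz
    have h1 : α * ψ z ≤ |α| * N := (le_abs_self _).trans
      (by rw [abs_mul]; exact mul_le_mul_of_nonneg_left (h.stream_le z hz) (abs_nonneg _))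
    have h2 : β * fluxPotential η P Q z ≤ |β| * (N ^ 2 * r) := (le_abs_self _).trans
      (by rw [abs_mul]; exact mul_le_mul_of_nonneg_left (h.abs_fluxPotential_le hz) (abs_nonneg _))
    have h3 := h.mem_strip z hz
    have h4 : δ * z.im ≤ |δ| * r :=
      mul_le_mul (le_abs_self _) h3.2 h3.1 (abs_nonneg _)
    have h5 : c * z.im ^ 2 ≤ c * r ^ 2 :=
      mul_le_mul_of_nonneg_left (pow_le_pow_left₀ h3.1 h3.2 2) hc
    linarith
  · intro x
    simp [h.bottom, fluxPotential_bottom]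
  -- The comparison function from below replaces `c y²` by its tangent line at the height of `z`;
  -- this lies below because `c ≥ 0`.
  · intro z hz
    refine ⟨fun w => α * ψ w + β * fluxPotential η P Q w + (δ + 2 * c * z.im) * w.im
      + -(c * z.im ^ 2),
      fun w => α * (P w - I * Q w) + β * (I / 2 * (P w - I * Q w) ^ 2)
        + (δ + 2 * c * z.im : ℝ) * (-I) + 0, ?_, ?_, ?_, ?_⟩
    · have := h.holomorphic z hz
      fun_prop
    · filter_upwards [h.eventually_mem hz] with w hw
      exact ((((h.hasConjGradAt_stream hw).const_mul α).add
        ((h.hasConjGradAt_fluxPotential hw).const_mul β)).add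
        (HasConjGradAt.im.const_mul _)).add (HasConjGradAt.const _)
    · refine Eventually.of_forall fun w => ?_
      nlinarith [mul_nonneg hc (sq_nonneg (w.im - z.im))]
    · ring

/-- The function `ψ - c y` is harmonic, zero on the bottom and nonpositive on the surface. This and
its reverse compare the wave with linear profiles. -/
theorem stream_le_mul_im {c : ℝ} (hc : ∀ x, 1 ≤ c * η x) :
    ∀ z ∈ closedFluidDomain η, ψ z ≤ c * z.im := by
  intro z hz
  have := h.combination_nonpos (α := 1) (β := 0) (δ := -c) le_rfl
    (fun x => by rw [h.surface]; linarith [hc x]) z hz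
  linarith

theorem mul_im_le_stream {c : ℝ} (hc : ∀ x, c * η x ≤ 1) :
    ∀ z ∈ closedFluidDomain η, c * z.im ≤ ψ z := by
  intro z hz
  have := h.combination_nonpos (α := -1) (β := 0) (δ := c) le_rfl
    (fun x => by rw [h.surface]; linarith [hc x]) z hz
  linarith

/-- The relation between the flow force and the bottom velocity. -/
theorem bottom_flowForce {S : ℝ} (hS : ∀ x, fluxPotential η P Q ⟨x, η x⟩ =
    S - (r * η x - η x ^ 2 / 2)) (x : ℝ) :
    0 ≤ Q ⟨x, 0⟩ ^ 2 / 2 + r - S * Q ⟨x, 0⟩ := by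
  -- By the definition of `S` this subharmonic combination is exactly zero on the surface as well as
  -- on the bottom; its vertical derivative at the bottom is therefore nonpositive.
  have h1 := h.combination_nonpos (α := S) (β := -1) (δ := -r) (c := 1 / 2) (by norm_num)
    (fun x => by rw [h.surface, hS x]; linarith)
  have hψ := (h.hasFDerivWithinAt_stream _ (h.bottom_mem x)).hasDerivWithinAt_vertical
  have hH := (h.hasDerivAt_fluxPotential_vertical (h.bottom_mem x)).hasDerivWithinAt
    (s := Icc 0 (η x))
  have hid := (hasDerivWithinAt_id (0 : ℝ) (Icc 0 (η x)))
  have h2 := (((hH.add (hid.const_mul r)).sub ((hid.pow 2).const_mul (1 / 2))).sub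
    (hψ.const_mul S)).nonneg_of_forall_le (h.depth_pos x) (fun t ht => by
      have := h1 ⟨x, t⟩ ht
      simp [h.bottom, fluxPotential_bottom] at this ⊢
      linarith)
  simp [h.P_bottom] at h2
  linarith

/-- A comparison of the flux potential with the stream function through the maximal depth. -/
theorem flux_nonneg {S d : ℝ} (hS : ∀ x, fluxPotential η P Q ⟨x, η x⟩ =
    S - (r * η x - η x ^ 2 / 2)) (hd : ∀ x, η x ≤ d) (hdr : d ≤ r) :
    ∀ z ∈ closedFluidDomain η,
      0 ≤ fluxPotential η P Q z + (r * d - d ^ 2 / 2 - S) * ψ z := by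
  intro z hz
  -- The surface value of `H + (r d - d² / 2 - S) ψ` is `(r d - d² / 2) - (r η - η² / 2)`,
  -- nonnegative because `t ↦ r t - t² / 2` increases for `t ≤ r`.
  have h1 := h.combination_nonpos (α := -(r * d - d ^ 2 / 2 - S)) (β := -1) (δ := 0) le_rfl
    (fun x => by
      rw [h.surface, hS x]
      nlinarith [mul_nonneg (sub_nonneg.2 (hd x)) (sub_nonneg.2 hdr),
        mul_nonneg (sub_nonneg.2 (hd x)) (sub_nonneg.2 (hd x))]) z hz
  linarith

/-- On the bottom `ψ_x = 0` and `ψ_yy = -ψ_xx = 0`, so the kinetic part is stationary and only the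
height contributes. The positive inward derivative excludes a maximum on the bottom. -/
theorem hasDerivWithinAt_energy_bottom (x : ℝ) :
    HasDerivWithinAt (fun t => (P ⟨x, t⟩ ^ 2 + Q ⟨x, t⟩ ^ 2) / 2 + t - r) 1
      (Icc 0 (η x)) 0 := by
  have hP := (h.hasFDerivWithinAt_P _ (h.bottom_mem x)).hasDerivWithinAt_vertical
  have hQ := (h.hasFDerivWithinAt_Q _ (h.bottom_mem x)).hasDerivWithinAt_vertical
  have hid := (hasDerivWithinAt_id (0 : ℝ) (Icc 0 (η x)))
  refine (((((hP.pow 2).add (hQ.pow 2)).div_const 2).add hid).sub_const r).congr_deriv ?_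
  simp [h.P_bottom, h.a_bottom]

/-- The pressure is nonnegative in the fluid. -/
theorem energy_le : ∀ z ∈ closedFluidDomain η, (P z ^ 2 + Q z ^ 2) / 2 + z.im - r ≤ 0 := by
  have hcont : ContinuousOn (fun z => (P z ^ 2 + Q z ^ 2) / 2 + z.im - r)
      (closedFluidDomain η) :=
    ((((h.continuousOn_P.pow 2).add (h.continuousOn_Q.pow 2)).div_const 2).add
      continuous_im.continuousOn).sub continuousOn_const
  refine nonpos_of_forall_not_isMaxOn h.isClosed h.mem_strip hcont (M := N ^ 2) ?_ ?_
  · intro z hz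
    have h1 := sq_le_sq' (abs_le.1 (h.P_le z hz)).1 (abs_le.1 (h.P_le z hz)).2
    have h2 := sq_le_sq' (abs_le.1 (h.Q_le z hz)).1 (abs_le.1 (h.Q_le z hz)).2
    linarith [(h.mem_strip z hz).2]
  intro z hz hpos ε hε
  by_cases h0 : z.im = 0
  · intro hmax
    have hzx : z = ⟨z.re, 0⟩ := Complex.ext rfl h0
    set x := z.re
    -- The barrier is even in `y`, so subtracting it does not alter the vertical derivative at the
    -- bottom.
    have hb : HasDerivWithinAt (fun t => ε * stripBarrier r ⟨x, t⟩) 0 (Icc 0 (η x)) 0 := by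
      have hid := (hasDerivWithinAt_id (0 : ℝ) (Icc 0 (η x)))
      refine ((((hid.pow 2).const_mul 2).const_sub (x ^ 2 + 2 * r ^ 2)).const_mul ε).congr_deriv ?_
      simp
    have := (hb.sub (h.hasDerivWithinAt_energy_bottom x)).nonneg_of_forall_le (h.depth_pos x)
      (fun t ht => by
        have := hmax (show (⟨x, t⟩ : ℂ) ∈ closedFluidDomain η from ht)
        rw [mem_ofPred_eq, hzx] at this
        simp only [Pi.sub_apply]
        linarith)
    linarith
  · have hz' : z ∈ fluidDomain η := by
      refine ⟨lt_of_le_of_ne hz.1 (Ne.symm h0), lt_of_le_of_ne hz.2 fun h1 => ?_⟩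
      have := h.bernoulli z.re
      rw [← h1, eta] at this
      linarith
    set W : ℂ → ℂ := fun w => (P w : ℂ) - I * Q w with hW
    have hWd : DifferentiableOn ℂ W (fluidDomain η) := fun w hw =>
      (h.holomorphic w hw).differentiableWithinAt
    have hWa : AnalyticAt ℂ W z :=
      hWd.analyticAt ((isOpen_fluidDomain h.continuous_profile).mem_nhds hz')
    have hre : ∀ w, (((P z : ℂ) + I * Q z) * W w).re = P z * P w + Q z * Q w := fun w => by
      simp [hW]
    -- The touching harmonic function linearizes the convex function `|W|² / 2` at the value `W z`;
    -- it is the real part of a holomorphic function plus an affine function of the height.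
    refine not_isMaxOn_sub_stripBarrier (closedFluidDomain_mem_nhds h.continuous_profile hz')
      (g := fun w => (((P z : ℂ) + I * Q z) * W w).re + w.im
        + (-(P z ^ 2 + Q z ^ 2) / 2 - r))
      (V := fun w => ((P z : ℂ) + I * Q z) * deriv W w + -I + 0) ?_ ?_ ?_ ?_ r hε
    · have := hWa.deriv.differentiableAt
      fun_prop
    · filter_upwards [h.eventually_mem hz'] with w hw
      exact ((HasConjGradAt.of_hasDerivAt ((h.holomorphic w hw).hasDerivAt.const_mul _)).add
        HasConjGradAt.im).add (HasConjGradAt.const _)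
    · refine Eventually.of_forall fun w => ?_
      simp only [hre]
      nlinarith [sq_nonneg (P w - P z), sq_nonneg (Q w - Q z)]
    · simp only [hre]
      ring

/-- In case of equality the energy function would attain its upper bound `0` on the bottom,
contradicting its inward derivative `1`. -/
theorem Q_bottom_sq_lt (x : ℝ) : Q ⟨x, 0⟩ ^ 2 < 2 * r := by
  have h1 := h.energy_le _ (h.bottom_mem x)
  simp only [h.P_bottom] at h1
  rcases lt_or_eq_of_le (show Q ⟨x, 0⟩ ^ 2 ≤ 2 * r by linarith) with h2 | h2
  · exact h2
  have h3 := (h.hasDerivWithinAt_energy_bottom x).neg.nonneg_of_forall_le (h.depth_pos x)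
    (fun t ht => by
      have := h.energy_le ⟨x, t⟩ ht
      simp only [Pi.neg_apply, h.P_bottom, h2]
      linarith)
  linarith

/-- The lower bound for the bottom velocity. -/
theorem inv_lt_Q_bottom (x₀ : ℝ) : 1 / r < Q ⟨x₀, 0⟩ := by
  have hr := h.energy_pos
  have hπ := Real.pi_pos
  -- The gap `r - η` may have infimum zero on the whole line, so strictness comes from a compact
  -- window. Its half-width `π / 2` makes the cosine in the barrier vanish on the lateral sides.
  obtain ⟨x₁, -, hx₁⟩ := (isCompact_Icc (a := x₀ - Real.pi / 2)
    (b := x₀ + Real.pi / 2)).exists_isMaxOn ⟨x₀, by constructor <;> linarith⟩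
    h.continuous_profile.continuousOn
  have hsinh : 0 < Real.sinh r := Real.sinh_pos_iff.2 hr
  have hgap : 0 < 1 - η x₁ / r := by
    rw [sub_pos, div_lt_one hr]
    exact h.profile_lt x₁
  -- This normalization keeps the barrier below `1 - η / r`, the value of `ψ - y / r` on the surface
  -- in the window.
  set κ := (1 - η x₁ / r) / Real.sinh r with hκ
  have hκ0 : 0 < κ := div_pos hgap hsinh
  set s : Set ℂ := closedFluidDomain η ∩ {z | |z.re - x₀| ≤ Real.pi / 2} with hs
  have hv : ∀ z ∈ closedFluidDomain η, z.im / r ≤ ψ z := by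
    intro z hz
    have := h.mul_im_le_stream (c := 1 / r) (fun x => by
      rw [one_div_mul_eq_div, div_le_one hr]
      exact (h.profile_lt x).le) z hz
    rwa [one_div_mul_eq_div] at this
  have hle : ∀ z ∈ s, κ * (Real.cos (z.re - x₀) * Real.sinh z.im) - (ψ z - z.im / r) ≤ 0 := by
    have hbd : ∀ z ∈ s, κ * (Real.cos (z.re - x₀) * Real.sinh z.im) ≤ 1 - η x₁ / r := by
      intro z hz
      have h1 := h.mem_strip z hz.1
      have h2 : Real.cos (z.re - x₀) * Real.sinh z.im ≤ 1 * Real.sinh r :=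
        mul_le_mul (Real.cos_le_one _) (Real.sinh_le_sinh.2 h1.2) (Real.sinh_nonneg_iff.2 h1.1)
          zero_le_one
      calc _ ≤ κ * (1 * Real.sinh r) := mul_le_mul_of_nonneg_left h2 hκ0.le
        _ = _ := by rw [hκ]; field_simp
    refine nonpos_of_touching (R := r) (M := 1 - η x₁ / r) (h.isClosed.inter
      (isClosed_le (by fun_prop) continuous_const)) (fun z hz => h.mem_strip z hz.1) ?_ ?_ ?_
    · have := h.continuousOn_stream.mono (inter_subset_left : s ⊆ _)
      have h2 : Continuous fun z : ℂ => κ * (Real.cos (z.re - x₀) * Real.sinh z.im) := by fun_prop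
      exact h2.continuousOn.sub (this.sub (continuous_im.div_const r).continuousOn)
    · intro z hz
      linarith [hbd z hz, hv z hz.1]
    · intro z hz hpos
      have hz1 : |z.re - x₀| < Real.pi / 2 := by
        refine lt_of_le_of_ne hz.2 fun h0 => ?_
        have : Real.cos (z.re - x₀) = 0 := by rw [← Real.cos_abs, h0, Real.cos_pi_div_two]
        rw [this] at hpos
        linarith [hv z hz.1]
      have hz2 : z ∈ fluidDomain η := by
        refine ⟨lt_of_le_of_ne hz.1.1 fun h0 => ?_, lt_of_le_of_ne hz.1.2 fun h0 => ?_⟩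
        · have h1 : ψ z = 0 := by
            rw [← h.bottom z.re]
            congr 1
            exact Complex.ext rfl h0.symm
          rw [h1, ← h0] at hpos
          simp at hpos
        · have h1 : ψ z = 1 := by
            rw [← h.surface z.re]
            congr 1
            exact Complex.ext rfl h0
          have h2 : η z.re ≤ η x₁ := hx₁ (by
            have := abs_le.1 (show |z.re - x₀| ≤ Real.pi / 2 from hz.2)
            constructor <;> linarith)
          have h3 : η z.re / r ≤ η x₁ / r := div_le_div_of_nonneg_right h2 hr.le
          rw [h1] at hpos
          have h4 := hbd z hz
          rw [h0] at hpos h4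
          linarith
      refine ⟨inter_mem (closedFluidDomain_mem_nhds h.continuous_profile hz2)
        ((((by fun_prop : Continuous fun w : ℂ => |w.re - x₀|).tendsto z).eventually_lt_const
          hz1).mono fun w hw => le_of_lt hw),
        fun w => κ * (-I * Complex.sin (w - x₀)).re + (-1 * ψ w + 1 / r * w.im),
        fun w => κ * (-I * (Complex.cos (w - x₀) * 1)) +
          ((-1 : ℝ) * (P w - I * Q w) + (1 / r : ℝ) * (-I)), ?_, ?_, ?_⟩
      · have := h.holomorphic z hz2
        fun_prop
      · filter_upwards [h.eventually_mem hz2] with w hw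
        refine ((HasConjGradAt.of_hasDerivAt (HasDerivAt.const_mul _ ?_)).const_mul κ).add
          (((h.hasConjGradAt_stream hw).const_mul _).add (HasConjGradAt.im.const_mul _))
        exact ((hasDerivAt_id w).sub_const (x₀ : ℂ)).csin
      · have hsin : ∀ w : ℂ, (-I * Complex.sin (w - x₀)).re =
            Real.cos (w.re - x₀) * Real.sinh w.im := fun w => by
          have : w - x₀ = ((w.re - x₀ : ℝ) : ℂ) + (w.im : ℂ) * I := by
            apply Complex.ext <;> simp
          rw [this, Complex.sin_add_mul_I, ← ofReal_sin, ← ofReal_cos, ← ofReal_cosh,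
            ← ofReal_sinh]
          simp only [mul_re, add_re, neg_re, neg_im, I_re, I_im, ofReal_re, ofReal_im, mul_im,
            add_im]
          ring
        have heq : ∀ w : ℂ, κ * (-I * Complex.sin (w - x₀)).re + (-1 * ψ w + 1 / r * w.im) =
            κ * (Real.cos (w.re - x₀) * Real.sinh w.im) - (ψ w - w.im / r) := fun w => by
          rw [hsin]
          ring
        exact ⟨Eventually.of_forall fun w => (heq w).le, heq z⟩
  have hψ := (h.hasFDerivWithinAt_stream _ (h.bottom_mem x₀)).hasDerivWithinAt_vertical
  have hid := (hasDerivWithinAt_id (0 : ℝ) (Icc 0 (η x₀)))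
  have hsh := (Real.hasDerivAt_sinh 0).hasDerivWithinAt (s := Icc 0 (η x₀))
  -- Differentiating the comparison at the bottom point gives `Q - 1 / r - κ ≥ 0`, strict since `κ >
  -- 0`.
  have h2 := ((hψ.sub (hid.div_const r)).sub (hsh.const_mul κ)).nonneg_of_forall_le
    (h.depth_pos x₀) (fun t ht => by
      have := hle ⟨x₀, t⟩ ⟨ht, by simp; positivity⟩
      simp [h.bottom] at this ⊢
      linarith)
  simp only [Real.cosh_zero, mul_one] at h2
  linarith

end FlowData

/-! ### Nearly extremal depths and bounds on the Bernoulli constant -/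

/-- At a point where a function bounded above is near its supremum, its derivative is small. -/
theorem abs_deriv_le_of_near_max {g g' : ℝ → ℝ} {N d t x : ℝ} (hN : 0 ≤ N)
    (hg : ∀ x, HasDerivAt g (g' x) x) (hL : ∀ x y, |g' x - g' y| ≤ N * |x - y|)
    (hd : ∀ y, g y ≤ d) (ht : 0 < t) (hx : d - g x ≤ t ^ 2) : |g' x| ≤ (1 + N) * t := by
  have hcont : Continuous g := continuous_iff_continuousAt.2 fun x => (hg x).continuousAt
  rw [abs_le]
  constructor
  -- The mean slope over a step `t` differs from `g' x` by at most `N t`. A steeper slope at `x`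
  -- would gain more than `t²` in one step and exceed `d`.
  · obtain ⟨ξ, hξ, hs⟩ := exists_hasDerivAt_eq_slope g g' (show x - t < x by linarith)
      hcont.continuousOn (fun y _ => hg y)
    have h1 := hL x ξ
    rw [abs_of_nonneg (by linarith [hξ.2] : 0 ≤ x - ξ)] at h1
    have h2 := abs_le.1 h1
    have h3 := hd (x - t)
    rw [eq_div_iff (by linarith)] at hs
    have h4 : N * (x - ξ) ≤ N * t := mul_le_mul_of_nonneg_left (by linarith [hξ.1]) hN
    by_contra! hc
    nlinarith
  · obtain ⟨ξ, hξ, hs⟩ := exists_hasDerivAt_eq_slope g g' (show x < x + t by linarith)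
      hcont.continuousOn (fun y _ => hg y)
    have h1 := hL x ξ
    rw [abs_sub_comm x ξ, abs_of_nonneg (by linarith [hξ.1] : 0 ≤ ξ - x)] at h1
    have h2 := abs_le.1 h1
    have h3 := hd (x + t)
    rw [eq_div_iff (by linarith)] at hs
    have h4 : N * (ξ - x) ≤ N * t := mul_le_mul_of_nonneg_left (by linarith [hξ.2]) hN
    by_contra! hc
    nlinarith

theorem le_of_forall_small {u v : ℝ} {f : ℝ → ℝ} {t₀ : ℝ} (ht₀ : 0 < t₀) (hf : ContinuousAt f 0)
    (hf0 : f 0 = v) (hle : ∀ t, 0 < t → t ≤ t₀ → u ≤ f t) : u ≤ v := by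
  rw [← hf0]
  refine ge_of_tendsto (hf.tendsto.mono_left (nhdsWithin_le_nhds (s := Ioi 0))) ?_
  filter_upwards [Ioc_mem_nhdsGT ht₀] with t ht using hle t ht.1 ht.2

namespace FlowData

variable {r N : ℝ} {η η' : ℝ → ℝ} {ψ P Q a b : ℂ → ℝ} (h : FlowData r η η' ψ P Q a b N)

include h

/-- A one-sided Taylor estimate at the surface along vertical lines. -/
theorem vertical_taylor (α β δ x : ℝ) {s : ℝ} (hs : 0 < s) (hsη : s ≤ η x) :
    s * (α * Q ⟨x, η x⟩ + β * ((Q ⟨x, η x⟩ ^ 2 - P ⟨x, η x⟩ ^ 2) / 2) + δ) ≤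
      (α * ψ ⟨x, η x⟩ + β * fluxPotential η P Q ⟨x, η x⟩ + δ * η x) -
      (α * ψ ⟨x, η x - s⟩ + β * fluxPotential η P Q ⟨x, η x - s⟩ + δ * (η x - s)) +
      (|α| * N + |β| * (2 * N ^ 2)) * s ^ 2 := by
  have hN := h.bound_pos
  set φ : ℝ → ℝ := fun y => α * ψ ⟨x, y⟩ + β * fluxPotential η P Q ⟨x, y⟩ + δ * y with hφ
  set φ' : ℝ → ℝ := fun y => α * Q ⟨x, y⟩ + β * ((Q ⟨x, y⟩ ^ 2 - P ⟨x, y⟩ ^ 2) / 2) + δ with hφ'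
  have hd : ∀ y ∈ Icc 0 (η x), HasDerivWithinAt φ (φ' y) (Icc 0 (η x)) y := by
    intro y hy
    have hy' : (⟨x, y⟩ : ℂ) ∈ closedFluidDomain η := hy
    have h1 := (h.hasFDerivWithinAt_stream _ hy').hasDerivWithinAt_vertical
    have h2 := (h.hasDerivAt_fluxPotential_vertical hy').hasDerivWithinAt (s := Icc 0 (η x))
    refine (((h1.const_mul α).add (h2.const_mul β)).add
      ((hasDerivWithinAt_id y _).const_mul δ)).congr_deriv ?_
    simp [hφ']
  obtain ⟨ξ, hξ, hξs⟩ := exists_hasDerivAt_eq_slope φ φ' (show η x - s < η x by linarith)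
    (fun y hy => ((hd y ⟨by linarith [hy.1], hy.2⟩).continuousWithinAt.mono
      (Icc_subset_Icc_left (by linarith))))
    (fun y hy => (hd y ⟨by linarith [hy.1], hy.2.le⟩).hasDerivAt
      (Icc_mem_nhds (by linarith [hy.1]) hy.2))
  have hlip : |φ' ξ - φ' (η x)| ≤ (|α| * N + |β| * (2 * N ^ 2)) * |ξ - η x| := by
    refine (convex_Icc 0 (η x)).norm_image_sub_le_of_norm_hasDerivWithin_le
      (f := φ') (f' := fun y => α * -a ⟨x, y⟩ +
        β * -(Q ⟨x, y⟩ * a ⟨x, y⟩ + P ⟨x, y⟩ * b ⟨x, y⟩)) (fun y hy => ?_) (fun y hy => ?_)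
      (right_mem_Icc.2 (h.depth_pos x).le) ⟨by linarith [hξ.1], hξ.2.le⟩
    · have hy' : (⟨x, y⟩ : ℂ) ∈ closedFluidDomain η := hy
      have h1 := (h.hasFDerivWithinAt_Q _ hy').hasDerivWithinAt_vertical
      have h2 := (h.hasFDerivWithinAt_momentum hy').hasDerivWithinAt_vertical
      exact ((h1.const_mul α).add (h2.const_mul β)).add_const δ
    · have hy' : (⟨x, y⟩ : ℂ) ∈ closedFluidDomain η := hy
      have habs : ∀ p q : ℝ, |p| ≤ N → |q| ≤ N → |p * q| ≤ N * N := fun p q hp hq => by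
        rw [abs_mul]
        exact mul_le_mul hp hq (abs_nonneg _) hN.le
      have h1 := habs _ _ (h.Q_le _ hy') (h.a_le _ hy')
      have h2 := habs _ _ (h.P_le _ hy') (h.b_le _ hy')
      refine (abs_add_le _ _).trans (add_le_add ?_ ?_)
      · rw [abs_mul, abs_neg]
        exact mul_le_mul_of_nonneg_left (h.a_le _ hy') (abs_nonneg _)
      · rw [abs_mul, abs_neg]
        refine mul_le_mul_of_nonneg_left ((abs_add_le _ _).trans ?_) (abs_nonneg _)
        linarith
  rw [eq_div_iff (by linarith)] at hξs
  rw [abs_of_nonpos (by linarith [hξ.2] : ξ - η x ≤ 0)] at hlip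
  set C := |α| * N + |β| * (2 * N ^ 2)
  have hC : 0 ≤ C := by positivity
  have h1 := (abs_le.1 hlip).1
  have h2 : C * -(ξ - η x) ≤ C * s := mul_le_mul_of_nonneg_left (by linarith [hξ.1]) hC
  change s * φ' (η x) ≤ φ (η x) - φ (η x - s) + C * s ^ 2
  have h3 : φ' (η x) ≤ φ' ξ + C * s := by linarith
  nlinarith

theorem inv_bound_le_profile (x : ℝ) : 1 / N ≤ η x := by
  rw [div_le_iff₀ h.bound_pos, mul_comm]
  exact h.one_le_bound_mul_profile x

/-- The slope and the surface velocity at a point where the depth is nearly maximal or minimal. -/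
theorem surface_speed {x t : ℝ} (ht : |η' x| ≤ (1 + N) * t) :
    P ⟨x, η x⟩ ^ 2 ≤ Q ⟨x, η x⟩ ^ 2 * ((1 + N) * t) ^ 2 := by
  have h1 := h.surface_kinematic x
  have h2 : P ⟨x, η x⟩ = -(Q ⟨x, η x⟩ * η' x) := by linarith
  rw [h2, neg_sq, mul_pow]
  refine mul_le_mul_of_nonneg_left ?_ (sq_nonneg _)
  rw [← sq_abs (η' x)]
  exact pow_le_pow_left₀ (abs_nonneg _) ht 2

/-- Since `ψ ≥ y / d` with near equality at a nearly highest surface point, the vertical velocity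
there is at most about `1 / d`; the slope is small, and Bernoulli's law gives the bound. A step `t`
into the fluid at a point within `t²` of the supremum leaves an error of order `t`. -/
theorem energy_le_of_isLUB {d : ℝ} (hd : IsLUB (range η) d) : r ≤ 1 / 2 * (1 / d) ^ 2 + d := by
  have hN := h.bound_pos
  have hle : ∀ x, η x ≤ d := fun x => hd.1 (mem_range_self x)
  have hd0 : 0 < d := (h.depth_pos 0).trans_le (hle 0)
  refine le_of_forall_small (t₀ := 1 / N) (f := fun t =>
    1 / 2 * ((1 / d + (1 / d + N) * t) ^ 2 * (1 + ((1 + N) * t) ^ 2)) + d) (by positivity)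
    (by fun_prop) (by simp) fun t ht htN => ?_
  obtain ⟨_, ⟨x, rfl⟩, hx⟩ := hd.exists_between (show d - t ^ 2 < d by linarith [pow_pos ht 2])
  have hq := h.Q_pos _ (h.top_mem x)
  have hp := h.surface_speed (abs_deriv_le_of_near_max hN.le h.hasDerivAt_profile
    h.slope_lipschitz hle ht (by linarith [hx.1] : d - η x ≤ t ^ 2))
  have hmin := h.mul_im_le_stream (c := 1 / d) (fun x => by
    rw [one_div_mul_eq_div, div_le_one hd0]; exact hle x) ⟨x, η x - t⟩
    ⟨by simpa using htN.trans (h.inv_bound_le_profile x), by simpa using ht.le⟩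
  have htay := h.vertical_taylor 1 0 (-(1 / d)) x ht (htN.trans (h.inv_bound_le_profile x))
  have hb := h.bernoulli x
  simp only [h.surface, abs_one, abs_zero] at htay hmin
  set q := Q ⟨x, η x⟩
  set p := P ⟨x, η x⟩
  have h1 : 1 - 1 / d * η x ≤ 1 / d * t ^ 2 := by
    have : 1 = 1 / d * d := by field_simp
    have h2 : 1 / d * (d - η x) ≤ 1 / d * t ^ 2 :=
      mul_le_mul_of_nonneg_left (by linarith [hx.1]) (by positivity)
    linarith
  have h2 : t * (q - 1 / d) ≤ t * ((1 / d + N) * t) := by nlinarith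
  have h3 : q ≤ 1 / d + (1 / d + N) * t := by linarith [le_of_mul_le_mul_left h2 ht]
  have h4 : q ^ 2 ≤ (1 / d + (1 / d + N) * t) ^ 2 := pow_le_pow_left₀ hq.le h3 2
  have h5 : q ^ 2 * (1 + ((1 + N) * t) ^ 2) ≤
      (1 / d + (1 / d + N) * t) ^ 2 * (1 + ((1 + N) * t) ^ 2) :=
    mul_le_mul_of_nonneg_right h4 (by positivity)
  linarith [hle x]

/-- At a nearly lowest surface point `ψ ≤ y / m` gives vertical velocity at least about `1 / m`. The
horizontal velocity only adds to the energy, so no slope estimate is needed. -/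
theorem le_energy_of_isGLB {m : ℝ} (hm : IsGLB (range η) m) : 1 / 2 * (1 / m) ^ 2 + m ≤ r := by
  have hN := h.bound_pos
  have hle : ∀ x, m ≤ η x := fun x => hm.1 (mem_range_self x)
  have hm0 : 0 < m := (by positivity : 0 < 1 / N).trans_le
    (hm.2 (by rintro _ ⟨x, rfl⟩; exact h.inv_bound_le_profile x))
  have hCpos : 0 < 1 + m * N := by positivity
  rw [← neg_le_neg_iff]
  -- The first bound on `t` keeps the vertical step in the fluid; the second keeps the lower bound
  -- for the velocity nonnegative, so that it may be squared.
  refine le_of_forall_small (t₀ := min (1 / N) (1 / (1 + m * N))) (f := fun t =>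
    -(1 / 2 * ((1 / m - (1 / m + N) * t) ^ 2) + m)) (by positivity)
    (by fun_prop) (by simp) fun t ht htN => ?_
  have htN1 := htN.trans (min_le_left _ _)
  have htN2 := htN.trans (min_le_right _ _)
  obtain ⟨_, ⟨x, rfl⟩, hx⟩ := hm.exists_between (show m < m + t ^ 2 by linarith [pow_pos ht 2])
  have hmin := h.stream_le_mul_im (c := 1 / m) (fun x => by
    rw [one_div_mul_eq_div, one_le_div hm0]; exact hle x) ⟨x, η x - t⟩
    ⟨by simpa using htN1.trans (h.inv_bound_le_profile x), by simpa using ht.le⟩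
  have htay := h.vertical_taylor (-1) 0 (1 / m) x ht (htN1.trans (h.inv_bound_le_profile x))
  have hb := h.bernoulli x
  simp only [h.surface, abs_neg, abs_one, abs_zero] at htay hmin
  set q := Q ⟨x, η x⟩
  set p := P ⟨x, η x⟩
  have h1 : 1 / m * η x - 1 ≤ 1 / m * t ^ 2 := by
    have : 1 = 1 / m * m := by field_simp
    have h2 : 1 / m * (η x - m) ≤ 1 / m * t ^ 2 :=
      mul_le_mul_of_nonneg_left (by linarith [hx.2]) (by positivity)
    linarith
  have h2 : t * (1 / m - q) ≤ t * ((1 / m + N) * t) := by nlinarith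
  have h3 : 1 / m - (1 / m + N) * t ≤ q := by linarith [le_of_mul_le_mul_left h2 ht]
  have h4 : 0 ≤ 1 / m - (1 / m + N) * t := by
    rw [le_div_iff₀ hCpos] at htN2
    have : 1 / m - (1 / m + N) * t = (1 - t * (1 + m * N)) / m := by field_simp
    rw [this]
    exact div_nonneg (by linarith) hm0.le
  have h5 := pow_le_pow_left₀ h4 h3 2
  nlinarith [sq_nonneg p, hle x]

/-! ### Flow force at the crest and the upper bound for the bottom velocity -/

/-- A lower bound for the flow force in terms of the maximal depth. -/
theorem flowForce_ge {S d : ℝ} (hS : ∀ x, fluxPotential η P Q ⟨x, η x⟩ =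
    S - (r * η x - η x ^ 2 / 2)) (hd : IsLUB (range η) d) :
    r * d - d ^ 2 / 2 + 1 / 2 * √(2 * (r - d)) ≤ S := by
  have hN := h.bound_pos
  have hle : ∀ x, η x ≤ d := fun x => hd.1 (mem_range_self x)
  have hdr : d ≤ r := hd.2 (by rintro _ ⟨x, rfl⟩; exact (h.profile_lt x).le)
  set τ := √(2 * (r - d)) with hτ
  have hτ0 : 0 ≤ τ := Real.sqrt_nonneg _
  have hτ2 : τ ^ 2 = 2 * (r - d) := Real.sq_sqrt (by linarith)
  set A := r * d - d ^ 2 / 2 with hA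
  set C := |A - S| * N + 1 * (2 * N ^ 2) with hC
  have hC0 : 0 ≤ C := by positivity
  rw [← neg_le_neg_iff]
  -- The surface velocity `q` may be arbitrarily small near the crests, as `d = r` is not excluded.
  -- The vertical step is therefore `t q`: every error term then carries the factor `q²`, and `q`
  -- cancels. The first bound on `t` gives `t q ≤ 1 / N ≤ η`, the second gives `e ≤ 1`.
  refine le_of_forall_small (t₀ := min (1 / N ^ 2) (1 / (1 + N))) (f := fun t =>
    -(A + 1 / 2 * (τ * (1 - ((1 + N) * t) ^ 2) / (1 + ((1 + N) * t) ^ 2)) - (1 + C) * t))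
    (by positivity) (ContinuousAt.neg (ContinuousAt.sub (ContinuousAt.add continuousAt_const
      (ContinuousAt.mul continuousAt_const (ContinuousAt.div (by fun_prop) (by fun_prop)
        (by simp)))) (by fun_prop))) (by simp) fun t ht htN => ?_
  have htN1 := htN.trans (min_le_left _ _)
  have htN2 := htN.trans (min_le_right _ _)
  obtain ⟨_, ⟨x, rfl⟩, hx⟩ := hd.exists_between (show d - t ^ 2 < d by linarith [pow_pos ht 2])
  have hq := h.Q_pos _ (h.top_mem x)
  have hqN : Q ⟨x, η x⟩ ≤ N := (le_abs_self _).trans (h.Q_le _ (h.top_mem x))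
  have hp := h.surface_speed (abs_deriv_le_of_near_max hN.le h.hasDerivAt_profile
    h.slope_lipschitz hle ht (by linarith [hx.1] : d - η x ≤ t ^ 2))
  have hsη : t * Q ⟨x, η x⟩ ≤ η x := by
    refine le_trans ?_ (h.inv_bound_le_profile x)
    calc t * Q ⟨x, η x⟩ ≤ 1 / N ^ 2 * N := mul_le_mul htN1 hqN hq.le (by positivity)
      _ = 1 / N := by field_simp
  have hmin := h.flux_nonneg hS hle hdr ⟨x, η x - t * Q ⟨x, η x⟩⟩
    ⟨by simpa using hsη, by simpa using (mul_pos ht hq).le⟩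
  have htay := h.vertical_taylor (A - S) 1 0 x (mul_pos ht hq) hsη
  have hb := h.bernoulli x
  rw [hS x] at htay
  simp only [h.surface, abs_one] at htay
  rw [← hC] at htay
  set q := Q ⟨x, η x⟩
  set p := P ⟨x, η x⟩
  set e := ((1 + N) * t) ^ 2 with he
  have he0 : 0 ≤ e := sq_nonneg _
  have he1 : e ≤ 1 := by
    rw [le_div_iff₀ (by positivity)] at htN2
    rw [he]
    exact pow_le_one₀ (by positivity) (by linarith)
  have hq2 : r - η x ≤ q ^ 2 := by nlinarith [pow_pos hq 2]
  -- The left side is `(d - η) (r - (d + η) / 2)`; the first factor is at most `t²`, and the second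
  -- at most `r - η ≤ q²`.
  have htop : A - (r * η x - η x ^ 2 / 2) ≤ t ^ 2 * q ^ 2 := by
    have h1 : A - (r * η x - η x ^ 2 / 2) ≤ (d - η x) * (r - η x) := by
      rw [hA]
      nlinarith [sq_nonneg (d - η x)]
    refine h1.trans (mul_le_mul (by linarith [hx.1]) hq2 (by linarith [h.profile_lt x])
      (sq_nonneg t))
  rw [← hA] at hmin
  have h1 : t * q * ((A - S) * q + (q ^ 2 - p ^ 2) / 2) ≤ t * q * ((1 + C) * (t * q)) := by
    linarith
  have h2 := le_of_mul_le_mul_left h1 (mul_pos ht hq)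
  have h3 : q * (A - S + q * (1 - e) / 2) ≤ q * ((1 + C) * t) := by linarith
  have h4 := le_of_mul_le_mul_left h3 hq
  have h5 : τ ≤ q * (1 + e) := by
    refine abs_le_of_sq_le_sq' (a := τ) (b := q * (1 + e)) ?_ (by positivity) |>.2
    have h6 : τ ^ 2 ≤ q ^ 2 * (1 + e) := by rw [hτ2]; linarith [hle x]
    have h7 : q ^ 2 * (1 + e) ≤ q ^ 2 * (1 + e) * (1 + e) :=
      le_mul_of_one_le_right (by positivity) (by linarith)
    linarith [mul_pow q (1 + e) 2]
  have h6 : τ * (1 - e) / (1 + e) ≤ q * (1 - e) := by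
    rw [div_le_iff₀ (by positivity)]
    linarith [mul_le_mul_of_nonneg_right h5 (sub_nonneg.2 he1)]
  linarith

/-- If the depth is less than the critical depth everywhere, the wave is a uniform stream. -/
theorem isUniformStream_of_lt_one {d : ℝ} (hd : IsLUB (range η) d) (hd1 : d < 1) :
    IsUniformStream d ψ η := by
  have hle : ∀ x, η x ≤ d := fun x => hd.1 (mem_range_self x)
  have hbdd : BddBelow (range η) := ⟨0, by rintro _ ⟨x, rfl⟩; exact (h.depth_pos x).le⟩
  have hm := isGLB_csInf (range_nonempty η) hbdd
  set m := sInf (range η)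
  have hge : ∀ x, m ≤ η x := fun x => hm.1 (mem_range_self x)
  have hm0 : 0 < m := (by have := h.bound_pos; positivity : 0 < 1 / N).trans_le
    (hm.2 (by rintro _ ⟨x, rfl⟩; exact h.inv_bound_le_profile x))
  have hmd : m ≤ d := (hge 0).trans (hle 0)
  have hd0 : 0 < d := hm0.trans_le hmd
  have h1 := (h.le_energy_of_isGLB hm).trans (h.energy_le_of_isLUB hd)
  have hmeq : m = d := by
    by_contra hne
    have hlt : m < d := lt_of_le_of_ne hmd hne
    -- This is the strict decrease of `1 / (2 t²) + t` below the critical depth `1`: for `m < d < 1`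
    -- the right side is positive, against `h1`.
    have h2 : 1 / 2 * (1 / m) ^ 2 + m - (1 / 2 * (1 / d) ^ 2 + d) =
        (d - m) * (d + m - 2 * m ^ 2 * d ^ 2) / (2 * m ^ 2 * d ^ 2) := by
      field_simp
      ring
    have h3 : m ^ 2 * d ^ 2 < m := by
      have : m * d ^ 2 < 1 := by nlinarith
      nlinarith
    have h4 : 0 < (d - m) * (d + m - 2 * m ^ 2 * d ^ 2) / (2 * m ^ 2 * d ^ 2) :=
      div_pos (mul_pos (by linarith) (by nlinarith)) (by positivity)
    linarith
  have hη : ∀ x, η x = d := fun x => le_antisymm (hle x) (hmeq ▸ hge x)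
  have hc : ∀ x, 1 / d * η x = 1 := fun x => by
    rw [hη]
    exact one_div_mul_cancel hd0.ne'
  refine ⟨hη, fun z hz => ?_⟩
  have h5 := h.stream_le_mul_im (fun x => (hc x).ge) z hz
  have h6 := h.mul_im_le_stream (fun x => (hc x).le) z hz
  rw [div_eq_inv_mul, ← one_div]
  exact le_antisymm h5 h6

/-- The upper bound for the bottom velocity. -/
theorem Q_bottom_lt (hne : ¬ ∃ d : ℝ, d < 1 ∧ IsUniformStream d ψ η) (x : ℝ) :
    Q ⟨x, 0⟩ < 4 / r := by
  have hr := h.energy_pos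
  have hbdd : BddAbove (range η) := ⟨r, by rintro _ ⟨x, rfl⟩; exact (h.profile_lt x).le⟩
  have hd := isLUB_csSup (range_nonempty η) hbdd
  set d := sSup (range η)
  have hd1 : 1 ≤ d := by
    by_contra! hlt
    exact hne ⟨d, hlt, h.isUniformStream_of_lt_one hd hlt⟩
  have hdr : d ≤ r := hd.2 (by rintro _ ⟨x, rfl⟩; exact (h.profile_lt x).le)
  obtain ⟨S, hS⟩ := h.exists_flowForce
  have hSd := h.flowForce_ge hS hd
  have hrd := h.energy_le_of_isLUB hd
  have hinv : (1 / d) ^ 2 ≤ 1 :=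
    pow_le_one₀ (by positivity) ((div_le_one (by linarith)).2 hd1)
  -- From `d ≥ 1` one gets `τ² = 2 (r - d) ≤ 1 / d² ≤ 1`. Then `r d - d² / 2 + τ / 2 = r² / 2 - τ⁴ /
  -- 8 + τ / 2`, and `τ⁴ ≤ τ`.
  have hSr : r ^ 2 / 2 ≤ S := by
    set τ := √(2 * (r - d))
    have hτ0 : 0 ≤ τ := Real.sqrt_nonneg _
    have hτ2 : τ ^ 2 = 2 * (r - d) := Real.sq_sqrt (by linarith)
    have hτ1 : τ ≤ 1 := by nlinarith
    have h1 : (r - d) ^ 2 = τ ^ 4 / 4 := by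
      rw [show τ ^ 4 = (τ ^ 2) ^ 2 by ring, hτ2]
      ring
    have h2 : τ ^ 4 ≤ τ := by
      calc τ ^ 4 = τ * τ ^ 3 := by ring
        _ ≤ τ * 1 := mul_le_mul_of_nonneg_left (pow_le_one₀ hτ0 hτ1) hτ0
        _ = τ := mul_one τ
    nlinarith
  have hu := h.Q_pos _ (h.bottom_mem x)
  have hq := h.bottom_flowForce hS x
  have hsq := h.Q_bottom_sq_lt x
  by_contra! hge
  rw [div_le_iff₀ hr] at hge
  have h1 : r ^ 2 / 2 * Q ⟨x, 0⟩ ≤ S * Q ⟨x, 0⟩ := mul_le_mul_of_nonneg_right hSr hu.le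
  -- With `u` the bottom velocity, `r² u / 2 ≤ S u ≤ u² / 2 + r < 2 r`, while `r u ≥ 4` would give
  -- `r² u / 2 ≥ 2 r`.
  nlinarith [mul_le_mul_of_nonneg_left hge hr.le]

end FlowData

theorem proposition5p1 (γ : ℝ≥0) (hγ₀ : 0 < γ) (hγ₁ : γ < 1) (r : ℝ) (hr : 3 / 2 < r)
    (ψ : ℂ → ℝ) (η : ℝ → ℝ) (hwave : IsIrrotationalWave γ r ψ η) :
    (∀ x : ℝ, 1 / r < partialY η ψ ⟨x, 0⟩) ∧
      ((¬ ∃ d : ℝ, d < 1 ∧ IsUniformStream d ψ η) →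
        ∀ x : ℝ, partialY η ψ ⟨x, 0⟩ < 4 / r) := by
  obtain ⟨η', a, b, N, h⟩ := hwave.exists_flowData
  exact ⟨h.inv_lt_Q_bottom, h.Q_bottom_lt⟩
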